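/- **Setting.** For even $n$ let $F_2\in\mathbb F_2^{n\times n/2}$ be the matrix that writes each coordinate of a message twice in a row. Let $A\in\mathbb F_2^{n\times n}$ be the accumulator ($A_{ij}=1$ iff $i\ge j$) and $D$ the discrete derivative ($D_{ij}=1$ iff $j=i$ or $j=i-1$), and let $M_\pi$ be the matrix of a permutation $\pi$ of the $n$ coordinates ($(M_\pi)_{ij}=1$ iff $\pi(i)=j$). Let $\pi_1,\dots,\pi_{2m}$ be independent uniformly random permutations. The rate $1/2$ code $R(DA)^m$ encodes $x\in\mathbb F_2^{n/2}$ as $$A M_{\pi_{2m}} D M_{\pi_{2m-1}}\cdots A M_{\pi_2} D M_{\pi_1}F_2\,x ,$$ and $R(AD)^m$ is defined in the same way with the roles of $A$ and $D$ exchanged. In either case the product may also be formed with $A^\top$ and $D^\top$ in place of $A$ and $D$ throughout. One round consists of two consecutive permute-and-multiply steps, so the vector after $k$ rounds is the partial product that ends with $M_{\pi_{2k}}$ and the matrix in front of it. The weight of a vector is its number of nonzero coordinates. Put $h=h_n=(\log_2 n)^2$. **The distance $\delta^{(m)}$.** Let $H(p)=p\log_2\frac1p+(1-p)\log_2\frac1{1-p}$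 and $f_A(\alpha,\beta)=\alpha-H(\beta)+(1-\alpha)H\!\left(\frac{\beta-\alpha/2}{1-\alpha}\right)$, which is defined for $0\le\alpha\le\min\{2\beta,2(1-\beta)\}$. The spectral shape functions of the $m$-fold repeat-accumulate codes $RA^m$ of rate $1/2$ are $$\hat r^{(0)}(\gamma)=\tfrac12H(\gamma),\qquad \hat r^{(m)}(\gamma)=\max_{0\le\alpha\le\min\{2\gamma,2(1-\gamma)\}}\bigl\{\hat r^{(m-1)}(\alpha)+f_A(\alpha,\gamma)\bigr\}\quad(m\ge1),$$ and $\delta^{(m)}=\max\{\delta\in[0,1/2):\hat r^{(m)}(e)=0\text{ for all }0\le e\le\delta\}$. **Theorem 5.1.** Fix $\varepsilon>0$ and $m$. For even $n$, consider the expected number, over the random permutations, of nonzero messages $x\in\mathbb F_2^{n/2}$ whose vector after $m-1$ rounds has weight at most $h$ or at least $n-h$, and whose codeword (the vector after $m$ rounds) has weight at most $(\delta^{(m)}-\varepsilon)n$. As $n\to\infty$ through even integers: 1. for $R(DA)^m$ with $m\ge2$, this number is $\tilde O\bigl(n^{1/4-m/2}\bigr)$; 2. for $R(AD)^m$ with $m\ge3$,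 this number is $\tilde O\bigl(n^{1/4-m/4}\bigr)$. In particular, each of these numbers is $1/\mathrm{poly}(n)$, that is, at most $n^{-c}$ for some constant $c>0$ and all sufficiently large even $n$. Here $\tilde O(g)$ means $O\bigl(g\cdot(\log n)^{c'}\bigr)$ for some constant $c'$; all constants may depend on $m$ and $\varepsilon$. -/

import Mathlib

open Filter Asymptotics
open scoped Matrix BigOperators

noncomputable section

namespace FastCodes

/-! ### The random codes `R(DA)^m` and `R(AD)^m` -/

/-- The repetition matrix `F_r`: every entry of a message of length `n / r` is written `r` times
in a row (coordinates are counted from `0`). -/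
def repetitionMatrix (r n : ℕ) : Matrix (Fin n) (Fin (n / r)) (ZMod 2) :=
  Matrix.of fun i j => if (i : ℕ) / r = (j : ℕ) then 1 else 0

/-- The accumulator `A`: prefix sums modulo 2. -/
def accMatrix (n : ℕ) : Matrix (Fin n) (Fin n) (ZMod 2) :=
  Matrix.of fun i j => if j ≤ i then 1 else 0

/-- The discrete derivative `D`: each coordinate plus the previous one, modulo 2. -/
def derivMatrix (n : ℕ) : Matrix (Fin n) (Fin n) (ZMod 2) :=
  Matrix.of fun i j => if i = j ∨ (j : ℕ) + 1 = (i : ℕ) then 1 else 0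

/-- A matrix, or its transpose if the flag is set.  (The dual of a code built with `A` and `D`
is built with `Aᵀ` and `Dᵀ`.) -/
def orient {n : ℕ} (transposed : Bool) (M : Matrix (Fin n) (Fin n) (ZMod 2)) :
    Matrix (Fin n) (Fin n) (ZMod 2) :=
  if transposed then Mᵀ else M

/-- One round: permute by `p.1`, apply `B`, permute by `p.2`, apply `C`. -/
def roundMap {n : ℕ} (B C : Matrix (Fin n) (Fin n) (ZMod 2))
    (p : Equiv.Perm (Fin n) × Equiv.Perm (Fin n)) (v : Fin n → ZMod 2) : Fin n → ZMod 2 :=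
  C *ᵥ (p.2.permMatrix (ZMod 2) *ᵥ (B *ᵥ (p.1.permMatrix (ZMod 2) *ᵥ v)))

/-- The vector obtained from the message `x` of the rate `1/2` code with `m` rounds `(B, C)`
and permutations `π`, after the first `k` rounds. Index `0` is the repeated message and
index `Fin.last m` is the codeword. -/
def stateAfter {n m : ℕ} (B C : Matrix (Fin n) (Fin n) (ZMod 2))
    (π : Fin m → Equiv.Perm (Fin n) × Equiv.Perm (Fin n)) (x : Fin (n / 2) → ZMod 2)
    (k : Fin (m + 1)) : Fin n → ZMod 2 :=
  Fin.induction (motive := fun _ => Fin n → ZMod 2) (repetitionMatrix 2 n *ᵥ x)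
    (fun i v => roundMap B C (π i) v) k

/-- The number of nonzero messages whose absolute weight after `m - 1` rounds is at most `h` or
at least `n - h`, and whose absolute weight after all `m` rounds is at most `d`. -/
def edgeCount {n m : ℕ} (B C : Matrix (Fin n) (Fin n) (ZMod 2)) (h d : ℝ)
    (π : Fin m → Equiv.Perm (Fin n) × Equiv.Perm (Fin n)) : ℕ :=
  Set.ncard {x : Fin (n / 2) → ZMod 2 | x ≠ 0 ∧
    ((hammingNorm (stateAfter B C π x ⟨m - 1, by omega⟩) : ℝ) ≤ h ∨
      (n : ℝ) - h ≤ (hammingNorm (stateAfter B C π x ⟨m - 1, by omega⟩) : ℝ)) ∧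
    (hammingNorm (stateAfter B C π x (Fin.last m)) : ℝ) ≤ d}

/-- The expectation of `edgeCount` when the `2 m` permutations are independent and uniform. -/
def expectedEdgeCount (m n : ℕ) (B C : Matrix (Fin n) (Fin n) (ZMod 2)) (h d : ℝ) : ℝ :=
  (∑ π : Fin m → Equiv.Perm (Fin n) × Equiv.Perm (Fin n), (edgeCount B C h d π : ℝ)) /
    (Fintype.card (Fin m → Equiv.Perm (Fin n) × Equiv.Perm (Fin n)) : ℝ)

/-! ### The relative distance `δ^(m)` -/

/-- Binary entropy, with base 2 logarithms. -/
def entropy (p : ℝ) : ℝ := Real.binEntropy p / Real.log 2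

/-- `f_A(α, β)`, the exponent of the probability that `A` takes relative weight `α` to `β`.
It is meaningful for `0 ≤ α ≤ min (2 β) (2 (1 - β))`. -/
def fA (α β : ℝ) : ℝ :=
  α - entropy β + (1 - α) * entropy ((β - α / 2) / (1 - α))

/-- The asymptotic spectral shape function of the rate `1/2` code `RA^m`; the maximum is over
all `α` for which `f_A(α, γ)` is defined. -/
def spectralShape : ℕ → ℝ → ℝ
  | 0, γ => entropy γ / 2
  | m + 1, γ => sSup ((fun α => spectralShape m α + fA α γ) ''
      Set.Icc 0 (min (2 * γ) (2 * (1 - γ))))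

/-- `δ^(m)`: the largest `δ` such that the spectral shape function vanishes on `[0, δ]`. -/
def deltaA (m : ℕ) : ℝ :=
  sSup {δ : ℝ | 0 ≤ δ ∧ δ < 1 / 2 ∧ ∀ e : ℝ, 0 ≤ e → e ≤ δ → spectralShape m e = 0}

/-! ### Asymptotic notation, for even `n` tending to infinity -/

/-- The filter of even `n` tending to infinity. -/
def evenAtTop : Filter ℕ := atTop ⊓ 𝓟 {n | Even n}

/-- `f = Õ(g)`, that is, `f = O((log n)^c g)` for some constant `c`. -/
def IsSoftO (f g : ℕ → ℝ) : Prop :=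
  ∃ c : ℕ, f =O[evenAtTop] fun n => Real.logb 2 (n : ℝ) ^ c * g n

/-- `f = 1/poly(n)`, that is, `|f| ≤ n^{-c}` eventually, for some constant `c > 0`. -/
def IsInversePoly (f : ℕ → ℝ) : Prop :=
  ∃ c : ℝ, 0 < c ∧ ∀ᶠ n in evenAtTop, |f n| ≤ (n : ℝ) ^ (-c)

/-- The width `h = (log n)^2` of the two ends of the weight range. -/
def edgeWidth (n : ℕ) : ℝ := Real.logb 2 (n : ℝ) ^ 2

/-- The expected number of nonzero messages of `R(DA)^m` of block length `n` (`D` is applied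
first in each round) with weight at most `h` or at least `n - h` after `m - 1` rounds
and final weight at most `(δ^(m) - ε) n`. -/
def starDA (transposed : Bool) (ε : ℝ) (m n : ℕ) : ℝ :=
  expectedEdgeCount m n (orient transposed (derivMatrix n)) (orient transposed (accMatrix n))
    (edgeWidth n) ((deltaA m - ε) * n)

/-- The same for `R(AD)^m` (`A` is applied first in each round). -/
def starAD (transposed : Bool) (ε : ℝ) (m n : ℕ) : ℝ :=
  expectedEdgeCount m n (orient transposed (accMatrix n)) (orient transposed (derivMatrix n))
    (edgeWidth n) ((deltaA m - ε) * n)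

end FastCodes

end

noncomputable section

namespace FastCodes

/-! ### Weight enumeration of the accumulator -/

/-! The condition on the final weight can be dropped: messages whose weight after `m - 1` rounds
lies near an end of the range `0, …, n` are already rare enough. Up to polylogarithmic factors their
expected number is at most `n^(1-m)` for `R(DA)^m` and `n^(2-m)` for `R(AD)^m`, which is stronger
than required.

A random permutation makes a vector uniform in its weight class, so the process is a Markov chain on
weights, governed by the weight enumerator of `A` (`accCount_eq`). The enumerator of `D` is obtained
by exchanging input and output, and transposing changes neither. The chain is followed through
densities: the expected number of nonzero messages sent to one given vector of weight `w`.

Two properties of the density matter. `SmallMiddle`: away from the ends it is smaller than any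
quasipolynomial, so that the at most `n^polylog` relevant vectors there contribute nothing.
`SmallEnds`: at distance `i` from an end it is about `n^(-⌈i/2⌉)`. Both hold at the start because
the square of the initial density is at most `1 / n.choose w`.

To end a round `DA` near an end, `D` must first produce a small weight `a`, and `A` then reaches an
end with probability about `n^(-⌈a/2⌉)`, at most about `1/n`. Hence every round divides the mass
near the ends by `n` (`edgeMass_round_le_div`). In the first round there is no bound on that mass to
start from, and `SmallEnds` gives `1/n` directly (`edgeTerm_le`). For `AD` the rounds regroup as
`A`, then `m - 2` rounds `DA`, then `D`; the outer two steps preserve what is needed but gain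
nothing. -/

/-- The number of vectors of weight `a` that `M` maps to a vector of weight `b`. -/
def weightCount {n : ℕ} (M : Matrix (Fin n) (Fin n) (ZMod 2)) (a b : ℕ) : ℕ :=
  (Finset.univ.filter fun v : Fin n → ZMod 2 =>
    hammingNorm v = a ∧ hammingNorm (M *ᵥ v) = b).card

/-- The input-output weight enumerator of the accumulator. -/
abbrev accCount (n a b : ℕ) : ℕ := weightCount (accMatrix n) a b

theorem hammingNorm_eq_sum {n : ℕ} (v : Fin n → ZMod 2) :
    hammingNorm v = ∑ i, if v i = 0 then 0 else 1 := by
  simp only [hammingNorm, Finset.card_filter, ite_not]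

theorem hammingNorm_cons {n : ℕ} (t : ZMod 2) (v : Fin n → ZMod 2) :
    hammingNorm (Fin.cons t v : Fin (n + 1) → ZMod 2) = (if t = 0 then 0 else 1) + hammingNorm v := by
  simp [hammingNorm_eq_sum, Fin.sum_univ_succ]

theorem hammingNorm_le {n : ℕ} (v : Fin n → ZMod 2) : hammingNorm v ≤ n := by
  simpa using hammingNorm_le_card_fintype (x := v)

theorem hammingNorm_one_add {n : ℕ} (v : Fin n → ZMod 2) :
    hammingNorm (fun i => 1 + v i) + hammingNorm v = n := by
  rw [hammingNorm_eq_sum, hammingNorm_eq_sum, ← Finset.sum_add_distrib]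
  have h : ∀ t : ZMod 2, ((if 1 + t = 0 then 0 else 1) + (if t = 0 then 0 else 1) : ℕ) = 1 := by
    decide
  simp [h]

theorem accMatrix_mulVec_cons {n : ℕ} (t : ZMod 2) (v : Fin n → ZMod 2) :
    accMatrix (n + 1) *ᵥ (Fin.cons t v : Fin (n + 1) → ZMod 2) =
      Fin.cons t (fun i => t + (accMatrix n *ᵥ v) i) := by
  funext i
  refine Fin.cases ?_ (fun i => ?_) i
  · simp [Matrix.mulVec, dotProduct, accMatrix]
  · simp [Matrix.mulVec, dotProduct, accMatrix, Fin.sum_univ_succ]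

theorem weightCount_eq_zero_of_lt {n : ℕ} (M : Matrix (Fin n) (Fin n) (ZMod 2)) {a b : ℕ}
    (h : n < b) : weightCount M a b = 0 := by
  rw [weightCount, Finset.card_eq_zero, Finset.filter_eq_empty_iff]
  rintro v - ⟨-, hv⟩
  have := hammingNorm_le (M *ᵥ v)
  omega

theorem weightCount_zero_left {n : ℕ} (M : Matrix (Fin n) (Fin n) (ZMod 2)) {b : ℕ} (hb : b ≠ 0) :
    weightCount M 0 b = 0 := by
  rw [weightCount, Finset.card_eq_zero, Finset.filter_eq_empty_iff]
  rintro v - ⟨h0, hv⟩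
  rw [hammingNorm_eq_zero] at h0
  simp [h0] at hv
  exact hb hv.symm

/-- Split on the first input bit. A leading 0 leaves the other outputs alone; a leading 1 outputs 1
and complements the rest, turning weight `n - b` into `b`. -/
theorem accCount_succ (n a b : ℕ) (hb : b ≤ n) :
    accCount (n + 1) (a + 1) (b + 1) = accCount n (a + 1) (b + 1) + accCount n a (n - b) := by
  simp only [accCount, weightCount, Finset.card_filter]
  rw [← (Fin.consEquiv fun _ : Fin (n + 1) => ZMod 2).sum_comp, Fintype.sum_prod_type]
  simp only [Fin.consEquiv, Equiv.coe_fn_mk, accMatrix_mulVec_cons, hammingNorm_cons]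
  rw [show (Finset.univ : Finset (ZMod 2)) = {0, 1} from rfl,
    Finset.sum_pair (by decide)]
  congr 1
  · simp
  · refine Finset.sum_congr rfl fun v _ => ?_
    have := hammingNorm_one_add (accMatrix n *ᵥ v)
    simp only [one_ne_zero, if_false]
    refine if_congr ⟨?_, ?_⟩ rfl rfl <;> rintro ⟨h1, h2⟩ <;> constructor <;> omega

/-- `A` is the inverse of `D`. -/
theorem derivMatrix_mul_accMatrix (n : ℕ) : derivMatrix n * accMatrix n = 1 := by
  ext i k
  have h1 : ∀ j : Fin n, derivMatrix n i j * accMatrix n j k =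
      (if i = j then (if k ≤ i then 1 else 0) else 0) +
        (if (j : ℕ) + 1 = i then (if k < i then 1 else 0) else 0) := by
    intro j
    simp only [derivMatrix, accMatrix, Matrix.of_apply]
    by_cases h : i = j
    · subst h; simp
    · by_cases h' : (j : ℕ) + 1 = i
      · have : k ≤ j ↔ k < i := by rw [Fin.le_def, Fin.lt_def]; omega
        simp [h, h', this]
      · simp [h, h']
  rw [Matrix.mul_apply, Finset.sum_congr rfl fun j _ => h1 j, Finset.sum_add_distrib]
  simp only [Finset.sum_ite_eq, Finset.mem_univ, if_true]
  rcases lt_trichotomy k i with h | h | h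
  · have hi : (i : ℕ) - 1 < n := by omega
    have : ∀ j : Fin n, ((j : ℕ) + 1 = i) ↔ (⟨i - 1, hi⟩ : Fin n) = j := by
      intro j
      rw [Fin.lt_def] at h
      rw [Fin.ext_iff]; simp; omega
    simp only [this, h, h.le, if_true, Finset.sum_ite_eq, Finset.mem_univ,
      Matrix.one_apply_ne h.ne']
    decide
  · subst h; simp
  · simp [h.not_ge, h.not_gt, Matrix.one_apply_ne h.ne]

theorem accMatrix_mul_derivMatrix (n : ℕ) : accMatrix n * derivMatrix n = 1 :=
  mul_eq_one_comm.mp (derivMatrix_mul_accMatrix n)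

/-- Exchanging input and output is a bijection. Every count about `D` can thus be read off from
`accCount`. -/
theorem weightCount_swap {n : ℕ} {M N : Matrix (Fin n) (Fin n) (ZMod 2)} (h : M * N = 1)
    (a b : ℕ) : weightCount M a b = weightCount N b a := by
  have h' : N * M = 1 := mul_eq_one_comm.mp h
  refine Finset.card_bij' (fun v _ => M *ᵥ v) (fun v _ => N *ᵥ v) ?_ ?_ ?_ ?_ <;>
    simp +contextual [Matrix.mulVec_mulVec, h, h']

/-- Reversing the coordinates turns suffix sums into prefix sums, so the transposed codes have the
same weight enumerators. -/
theorem accMatrix_transpose_mulVec {n : ℕ} (v : Fin n → ZMod 2) :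
    ((accMatrix n)ᵀ *ᵥ v) ∘ Fin.rev = accMatrix n *ᵥ (v ∘ Fin.rev) := by
  funext i
  simp only [Matrix.mulVec, dotProduct, Function.comp_apply]
  rw [← Equiv.sum_comp Fin.revPerm]
  refine Finset.sum_congr rfl fun j _ => ?_
  simp [accMatrix]

theorem hammingNorm_comp_perm {n : ℕ} (σ : Equiv.Perm (Fin n)) (v : Fin n → ZMod 2) :
    hammingNorm (v ∘ σ) = hammingNorm v := by
  rw [hammingNorm_eq_sum, hammingNorm_eq_sum]
  exact Equiv.sum_comp σ fun i => if v i = 0 then 0 else 1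

theorem weightCount_acc_transpose (n a b : ℕ) :
    weightCount (accMatrix n)ᵀ a b = accCount n a b := by
  have hrev : ∀ v : Fin n → ZMod 2, hammingNorm (v ∘ Fin.rev) = hammingNorm v :=
    fun v => hammingNorm_comp_perm Fin.revPerm v
  have hA : ∀ v : Fin n → ZMod 2, hammingNorm (accMatrix n *ᵥ (v ∘ Fin.rev)) =
      hammingNorm ((accMatrix n)ᵀ *ᵥ v) := fun v => by
    rw [← accMatrix_transpose_mulVec, hrev]
  have hinv : ∀ v : Fin n → ZMod 2, (v ∘ Fin.rev) ∘ Fin.rev = v := fun v => by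
    funext i; simp
  refine Finset.card_bij' (fun v _ => v ∘ Fin.rev) (fun v _ => v ∘ Fin.rev) ?_ ?_ ?_ ?_
  · intro v hv
    simpa [hrev, hA] using hv
  · intro v hv
    have := hA (v ∘ Fin.rev)
    rw [hinv] at this
    simpa [hrev, ← this] using hv
  · exact fun v _ => hinv v
  · exact fun v _ => hinv v

theorem weightCount_orient_acc (t : Bool) (n a b : ℕ) :
    weightCount (orient t (accMatrix n)) a b = accCount n a b := by
  cases t
  · rfl
  · exact weightCount_acc_transpose n a b

theorem orient_acc_mul_orient_deriv (t : Bool) (n : ℕ) :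
    orient t (accMatrix n) * orient t (derivMatrix n) = 1 := by
  cases t
  · exact accMatrix_mul_derivMatrix n
  · simp [orient, ← Matrix.transpose_mul, derivMatrix_mul_accMatrix]

theorem weightCount_orient_deriv (t : Bool) (n a b : ℕ) :
    weightCount (orient t (derivMatrix n)) a b = accCount n b a := by
  rw [← weightCount_orient_acc t, weightCount_swap (orient_acc_mul_orient_deriv t n)]

theorem card_hammingNorm_eq (n a : ℕ) :
    (Finset.univ.filter fun v : Fin n → ZMod 2 => hammingNorm v = a).card = n.choose a := by
  have h2 : ∀ t : ZMod 2, t ≠ 0 → t = 1 := by decide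
  conv_rhs => rw [← Fintype.card_fin n, ← Finset.card_univ, ← Finset.card_powersetCard]
  refine Finset.card_bij' (fun v _ => Finset.univ.filter fun i => v i ≠ 0)
    (fun s _ i => if i ∈ s then 1 else 0) ?_ ?_ ?_ ?_
  · intro v hv
    simpa [Finset.mem_powersetCard, hammingNorm] using hv
  · intro s hs
    simpa [Finset.mem_powersetCard, hammingNorm] using hs
  · intro v hv
    funext i
    by_cases h : v i = 0
    · simp [h]
    · simp [h2 _ h]
  · intro s hs
    ext i; simp

theorem sum_weightCount {n : ℕ} (M : Matrix (Fin n) (Fin n) (ZMod 2)) (a : ℕ) :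
    ∑ b ∈ Finset.range (n + 1), weightCount M a b = n.choose a := by
  rw [← card_hammingNorm_eq, Finset.card_eq_sum_card_fiberwise
    (f := fun v : Fin n → ZMod 2 => hammingNorm (M *ᵥ v)) (t := Finset.range (n + 1))]
  · simp [weightCount, Finset.filter_filter]
  · intro v _
    simpa using Nat.lt_succ_of_le (hammingNorm_le _)

theorem sum_accCount (n a : ℕ) :
    ∑ b ∈ Finset.range (n + 1), accCount n a b = n.choose a := sum_weightCount _ a

theorem sum_accCount_left (n b : ℕ) :
    ∑ a ∈ Finset.range (n + 1), accCount n a b = n.choose b := by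
  rw [← sum_weightCount (derivMatrix n) b]
  exact Finset.sum_congr rfl fun a _ => (weightCount_orient_deriv false n b a).symm

theorem accCount_eq_zero_of_lt {n a b : ℕ} (h : n < b) : accCount n a b = 0 :=
  weightCount_eq_zero_of_lt _ h

theorem accCount_zero_left {n b : ℕ} (hb : b ≠ 0) : accCount n 0 b = 0 :=
  weightCount_zero_left _ hb

theorem accCount_zero_right {n a : ℕ} (ha : a ≠ 0) : accCount n a 0 = 0 := by
  rw [← weightCount_orient_deriv false]
  exact weightCount_zero_left _ ha

theorem accCount_self_zero (n : ℕ) : accCount n 0 0 = 1 := by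
  have := sum_accCount n 0
  rw [Finset.sum_eq_single 0 (fun b _ hb => accCount_zero_left hb) (by simp)] at this
  simpa using this

/-- The closed form of the weight enumerator of the accumulator. -/
theorem accCount_eq (n : ℕ) : ∀ b d k : ℕ, n = b + d + 1 →
    accCount n (2 * k + 1) (b + 1) = d.choose k * b.choose k ∧
    accCount n (2 * k + 2) (b + 1) = d.choose (k + 1) * b.choose k := by
  induction n with
  | zero => intro b d k h; omega
  | succ n ih =>
    intro b d k h
    have hn : n = b + d := by omega
    have hb : n - b = d := by omega
    rw [accCount_succ n _ b (by omega), accCount_succ n _ b (by omega), hb]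
    rcases d with _ | d
    · have hz : ∀ a, accCount n a (b + 1) = 0 := fun a => accCount_eq_zero_of_lt (by omega)
      rw [hz, hz]
      rcases k with _ | k
      · simp [accCount_self_zero, accCount_zero_right]
      · simp [accCount_zero_right]
    · obtain ⟨h1, h2⟩ := ih b d k (by omega)
      -- The complemented summand has output weight `d + 1`, so the induction hypothesis applies
      -- with `b` and `d` exchanged; Pascal's rule then joins the two summands.
      obtain ⟨h3, -⟩ := ih d b k (by omega)
      rw [h1, h2, h3]
      constructor
      · rcases k with _ | k
        · simp [accCount_zero_left]
        · obtain ⟨-, h4⟩ := ih d b k (by omega)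
          rw [show 2 * (k + 1) = 2 * k + 2 by ring, h4, Nat.choose_succ_succ]
          ring
      · rw [Nat.choose_succ_succ]
        ring

theorem exists_of_accCount_ne_zero {n a b : ℕ} (ha : a ≠ 0) (h : accCount n a b ≠ 0) :
    ∃ b' d, b = b' + 1 ∧ n = b' + d + 1 := by
  have hb : b ≠ 0 := fun hb => h (by rw [hb]; exact accCount_zero_right ha)
  have hn : b ≤ n := not_lt.mp fun hn => h (accCount_eq_zero_of_lt hn)
  exact ⟨b - 1, n - b, by omega, by omega⟩

/-- A nonzero binomial coefficient in the closed form bounds its lower index. Consequently outputs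
within `L` of either end come only from inputs of weight at most `2 * L + 1`. -/
theorem le_of_accCount_ne_zero {n a b : ℕ} (ha : a ≠ 0) (h : accCount n a b ≠ 0) :
    a ≤ 2 * b ∧ a ≤ 2 * (n - b) + 1 ∧ b ≤ n := by
  obtain ⟨b, d, rfl, hn⟩ := exists_of_accCount_ne_zero ha h
  have hc : ∀ {x y : ℕ}, x.choose y ≠ 0 → y ≤ x := fun {x y} hxy =>
    not_lt.mp fun hlt => hxy (Nat.choose_eq_zero_of_lt hlt)
  rcases Nat.even_or_odd' a with ⟨k, rfl | rfl⟩
  · obtain ⟨k, rfl⟩ : ∃ j, k = j + 1 := ⟨k - 1, by omega⟩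
    rw [show 2 * (k + 1) = 2 * k + 2 by ring, (accCount_eq n b d k hn).2] at h
    have h1 := hc (left_ne_zero_of_mul h)
    have h2 := hc (right_ne_zero_of_mul h)
    omega
  · rw [(accCount_eq n b d k hn).1] at h
    have h1 := hc (left_ne_zero_of_mul h)
    have h2 := hc (right_ne_zero_of_mul h)
    omega

/-- `b` lies within `L` of one of the two ends of the weight range `0, …, n`. -/
def Edge (n L b : ℕ) : Prop := b ≤ L ∨ n ≤ b + L

instance (n L b : ℕ) : Decidable (Edge n L b) := inferInstanceAs (Decidable (_ ∨ _))

/-- Near an end, one binomial coefficient of the closed form has upper index at most `L`; the other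
has lower index at most `a / 2`, so only half of the input weight costs powers of `n`. -/
theorem accCount_le_of_edge {n L a b : ℕ} (ha : a ≠ 0) (hb : Edge n L b) :
    accCount n a b ≤ n ^ (a / 2) * (L + 1) ^ a := by
  by_cases h : accCount n a b = 0
  · rw [h]; exact Nat.zero_le _
  obtain ⟨b, d, rfl, hn⟩ := exists_of_accCount_ne_zero ha h
  have hpow : ∀ {x y z : ℕ}, x ≤ L → y ≤ z → x.choose y ≤ (L + 1) ^ z := fun {x y z} hx hy =>
    (Nat.choose_le_pow x y).trans ((Nat.pow_le_pow_left (by omega) y).trans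
      (Nat.pow_le_pow_right (by omega) hy))
  have hpow' : ∀ {x y z : ℕ}, x ≤ n → y ≤ z → x.choose y ≤ n ^ z := fun {x y z} hx hy =>
    (Nat.choose_le_pow x y).trans ((Nat.pow_le_pow_left hx y).trans
      (Nat.pow_le_pow_right (by omega) hy))
  rcases Nat.even_or_odd' a with ⟨k, rfl | rfl⟩
  · obtain ⟨k, rfl⟩ : ∃ j, k = j + 1 := ⟨k - 1, by omega⟩
    rw [show 2 * (k + 1) = 2 * k + 2 by ring, (accCount_eq n b d k hn).2]
    rcases hb with hb | hb
    · exact Nat.mul_le_mul (hpow' (by omega) (by omega)) (hpow (by omega) (by omega))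
    · rw [mul_comm]
      exact Nat.mul_le_mul (hpow' (by omega) (by omega)) (hpow (by omega) (by omega))
  · rw [(accCount_eq n b d k hn).1]
    rcases hb with hb | hb
    · exact Nat.mul_le_mul (hpow' (by omega) (by omega)) (hpow (by omega) (by omega))
    · rw [mul_comm]
      exact Nat.mul_le_mul (hpow' (by omega) (by omega)) (hpow (by omega) (by omega))

theorem accCount_le_choose_left (n a b : ℕ) : accCount n a b ≤ n.choose a := by
  rw [← card_hammingNorm_eq, accCount, weightCount]
  exact Finset.card_le_card fun v hv => by simp at hv ⊢; exact hv.1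

/-- The distance to the nearer end of the weight range. -/
def endDist (n b : ℕ) : ℕ := min b (n - b)

theorem edge_iff {n L b : ℕ} (hb : b ≤ n) : Edge n L b ↔ endDist n b ≤ L := by
  simp only [Edge, endDist]; omega

theorem choose_endDist {n b : ℕ} (hb : b ≤ n) : n.choose (endDist n b) = n.choose b := by
  rcases le_total b (n - b) with h | h
  · rw [endDist, min_eq_left h]
  · rw [endDist, min_eq_right h, Nat.choose_symm hb]

theorem pow_le_pow_mul_choose {n r : ℕ} (hr : r ≤ n) : n ^ r ≤ r ^ r * n.choose r := by
  induction r generalizing n with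
  | zero => simp
  | succ r ih =>
    obtain ⟨n, rfl⟩ : ∃ k, n = k + 1 := ⟨n - 1, by omega⟩
    have h1 := ih (n := n) (by omega)
    have h2 : (n + 1) * n.choose r = (n + 1).choose (r + 1) * (r + 1) := Nat.add_one_mul_choose_eq n r
    rcases Nat.eq_zero_or_pos r with rfl | hr0
    · simp
    -- This is `1 + 1/n ≤ 1 + 1/r`, raised to the power `r`.
    have h3 : (n + 1) ^ r * r ^ r ≤ (r + 1) ^ r * n ^ r := by
      rw [← mul_pow, ← mul_pow]
      exact Nat.pow_le_pow_left (by nlinarith) r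
    have h4 : (n + 1) ^ r ≤ (r + 1) ^ r * n.choose r := by
      have : (n + 1) ^ r * r ^ r ≤ ((r + 1) ^ r * n.choose r) * r ^ r := by
        calc _ ≤ (r + 1) ^ r * n ^ r := h3
          _ ≤ (r + 1) ^ r * (r ^ r * n.choose r) := Nat.mul_le_mul_left _ h1
          _ = _ := by ring
      exact Nat.le_of_mul_le_mul_right this (by positivity)
    calc (n + 1) ^ (r + 1) = (n + 1) ^ r * (n + 1) := pow_succ _ _
      _ ≤ (r + 1) ^ r * n.choose r * (n + 1) := Nat.mul_le_mul_right _ h4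
      _ = (r + 1) ^ r * ((n + 1) * n.choose r) := by ring
      _ = (r + 1) ^ (r + 1) * (n + 1).choose (r + 1) := by rw [h2]; ring

theorem pow_endDist_le {n b : ℕ} (hb : b ≤ n) :
    n ^ endDist n b ≤ endDist n b ^ endDist n b * n.choose b := by
  rw [← choose_endDist hb]
  exact pow_le_pow_mul_choose ((min_le_left _ _).trans hb)

theorem two_pow_endDist_le {n b : ℕ} (hb : b ≤ n) : 2 ^ endDist n b ≤ n.choose b := by
  rcases Nat.eq_zero_or_pos (endDist n b) with h | h
  · rw [h]; exact Nat.choose_pos hb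
  · have h1 := pow_endDist_le hb
    have h2 : (2 * endDist n b) ^ endDist n b ≤ n ^ endDist n b :=
      Nat.pow_le_pow_left (by simp only [endDist]; omega) _
    rw [mul_pow, mul_comm] at h2
    exact Nat.le_of_mul_le_mul_left (h2.trans h1) (by positivity)

theorem choose_le_pow_endDist {n b : ℕ} (hb : b ≤ n) : n.choose b ≤ n ^ endDist n b := by
  rw [← choose_endDist hb]
  exact Nat.choose_le_pow _ _

theorem card_edge_le (n L : ℕ) :
    ((Finset.range (n + 1)).filter (Edge n L)).card ≤ 2 * (L + 1) := by
  calc _ ≤ (Finset.range (L + 1) ∪ (Finset.range (L + 1)).image (fun i => n - i)).card := by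
        refine Finset.card_le_card fun b hb => ?_
        simp only [Finset.mem_filter, Finset.mem_range, Edge] at hb
        simp only [Finset.mem_union, Finset.mem_range, Finset.mem_image]
        rcases hb.2 with h | h
        · left; omega
        · right; exact ⟨n - b, by omega, by omega⟩
    _ ≤ (L + 1) + (L + 1) := (Finset.card_union_le _ _).trans
        (add_le_add (by simp) (Finset.card_image_le.trans (by simp)))
    _ = _ := by ring

/-! ### Averaging over the permutations -/

theorem exists_comp_perm_eq {n : ℕ} {v w : Fin n → ZMod 2} (h : hammingNorm v = hammingNorm w) :
    ∃ σ : Equiv.Perm (Fin n), w ∘ σ = v := by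
  obtain ⟨σ, hσ⟩ := Equiv.Perm.exists_map_finset_eq (Finset.univ.filter fun i => v i ≠ 0)
    (Finset.univ.filter fun i => w i ≠ 0) h
  refine ⟨σ, funext fun i => ?_⟩
  have h2 : ∀ s t : ZMod 2, (s ≠ 0 ↔ t ≠ 0) → s = t := by decide
  apply h2
  have : σ i ∈ (Finset.univ.filter fun i => v i ≠ 0).map σ.toEmbedding ↔
      σ i ∈ (Finset.univ.filter fun i => w i ≠ 0) := by rw [hσ]
  simpa using this.symm

/-- The vectors of one weight form a single orbit, so the sum over permutations is the same for each
of them. Summing over the orbit as well and exchanging the sums gives the identity. -/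
theorem choose_mul_sum_comp_perm {n : ℕ} (v : Fin n → ZMod 2) (g : (Fin n → ZMod 2) → ℝ) :
    (n.choose (hammingNorm v) : ℝ) * ∑ σ : Equiv.Perm (Fin n), g (v ∘ σ) =
      (Fintype.card (Equiv.Perm (Fin n)) : ℝ) *
        ∑ y ∈ Finset.univ.filter (fun y : Fin n → ZMod 2 => hammingNorm y = hammingNorm v), g y := by
  have h1 : ∀ y ∈ Finset.univ.filter (fun y : Fin n → ZMod 2 => hammingNorm y = hammingNorm v),
      ∑ σ : Equiv.Perm (Fin n), g (y ∘ σ) = ∑ σ : Equiv.Perm (Fin n), g (v ∘ σ) := by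
    intro y hy
    obtain ⟨τ, rfl⟩ := exists_comp_perm_eq (Finset.mem_filter.mp hy).2
    exact Equiv.sum_comp (Equiv.mulLeft τ) fun σ : Equiv.Perm (Fin n) => g (v ∘ σ)
  rw [← card_hammingNorm_eq, ← nsmul_eq_mul, ← Finset.sum_const, ← Finset.sum_congr rfl h1,
    Finset.sum_comm, Fintype.card, ← nsmul_eq_mul, ← Finset.sum_const]
  refine Finset.sum_congr rfl fun σ _ => ?_
  refine Finset.sum_bij' (fun y _ => y ∘ σ) (fun y _ => y ∘ σ.symm) ?_ ?_ ?_ ?_ ?_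
  · intro y hy
    simpa [hammingNorm_comp_perm] using hy
  · intro y hy
    simpa [hammingNorm_comp_perm] using hy
  · intro y _; funext i; simp
  · intro y _; funext i; simp
  · intro y _; rfl

/-- The expected value of `f` at the weight of `M` times a uniformly random vector of weight `a`. -/
def kernel {n : ℕ} (M : Matrix (Fin n) (Fin n) (ZMod 2)) (f : ℕ → ℝ) (a : ℕ) : ℝ :=
  (∑ b ∈ Finset.range (n + 1), (weightCount M a b : ℝ) * f b) / n.choose a

theorem sum_perm_eq_kernel {n : ℕ} (M : Matrix (Fin n) (Fin n) (ZMod 2)) (f : ℕ → ℝ)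
    (v : Fin n → ZMod 2) :
    ∑ σ : Equiv.Perm (Fin n), f (hammingNorm (M *ᵥ (σ.permMatrix (ZMod 2) *ᵥ v))) =
      Fintype.card (Equiv.Perm (Fin n)) * kernel M f (hammingNorm v) := by
  have hc : (n.choose (hammingNorm v) : ℝ) ≠ 0 := by
    exact_mod_cast (Nat.choose_pos (hammingNorm_le v)).ne'
  have h := choose_mul_sum_comp_perm v fun y => f (hammingNorm (M *ᵥ y))
  simp only [Matrix.permMatrix_mulVec]
  rw [kernel, mul_div_assoc', eq_div_iff hc, mul_comm, h]
  congr 1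
  rw [← Finset.sum_fiberwise_of_maps_to (g := fun y => hammingNorm (M *ᵥ y))
    (t := Finset.range (n + 1)) (fun y _ => by simpa using Nat.lt_succ_of_le (hammingNorm_le _))]
  refine Finset.sum_congr rfl fun b _ => ?_
  rw [Finset.filter_filter, Finset.sum_congr rfl (g := fun _ => f b), Finset.sum_const,
    nsmul_eq_mul, weightCount]
  intro y hy
  rw [(Finset.mem_filter.mp hy).2.2]

theorem sum_roundMap_eq_kernel {n : ℕ} (B C : Matrix (Fin n) (Fin n) (ZMod 2)) (f : ℕ → ℝ)
    (v : Fin n → ZMod 2) :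
    ∑ p : Equiv.Perm (Fin n) × Equiv.Perm (Fin n), f (hammingNorm (roundMap B C p v)) =
      Fintype.card (Equiv.Perm (Fin n) × Equiv.Perm (Fin n)) *
        kernel B (kernel C f) (hammingNorm v) := by
  rw [Fintype.sum_prod_type]
  simp only [roundMap, sum_perm_eq_kernel C f]
  rw [← Finset.mul_sum, sum_perm_eq_kernel B, Fintype.card_prod]
  push_cast
  ring

theorem stateAfter_succ {n m : ℕ} (B C : Matrix (Fin n) (Fin n) (ZMod 2))
    (π : Fin m → Equiv.Perm (Fin n) × Equiv.Perm (Fin n)) (x : Fin (n / 2) → ZMod 2) (k : Fin m) :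
    stateAfter B C π x k.succ = roundMap B C (π k) (stateAfter B C π x k.castSucc) := by
  simp only [stateAfter, Fin.induction_succ]

theorem stateAfter_zero {n m : ℕ} (B C : Matrix (Fin n) (Fin n) (ZMod 2))
    (π : Fin m → Equiv.Perm (Fin n) × Equiv.Perm (Fin n)) (x : Fin (n / 2) → ZMod 2) :
    stateAfter B C π x 0 = repetitionMatrix 2 n *ᵥ x := by
  simp only [stateAfter, Fin.induction_zero]

theorem stateAfter_congr {n m : ℕ} (B C : Matrix (Fin n) (Fin n) (ZMod 2))
    {π π' : Fin m → Equiv.Perm (Fin n) × Equiv.Perm (Fin n)} (x : Fin (n / 2) → ZMod 2)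
    (k : Fin (m + 1)) (h : ∀ i : Fin m, i.castSucc < k → π i = π' i) :
    stateAfter B C π x k = stateAfter B C π' x k := by
  induction k using Fin.induction with
  | zero => rw [stateAfter_zero, stateAfter_zero]
  | succ k ih =>
    rw [stateAfter_succ, stateAfter_succ, h k (Fin.castSucc_lt_succ),
      ih fun i hi => h i (hi.trans Fin.castSucc_lt_succ)]

theorem sum_stateAfter_eq_kernel {n m : ℕ} (B C : Matrix (Fin n) (Fin n) (ZMod 2))
    (x : Fin (n / 2) → ZMod 2) (k : Fin (m + 1)) (f : ℕ → ℝ) :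
    ∑ π : Fin m → Equiv.Perm (Fin n) × Equiv.Perm (Fin n),
        f (hammingNorm (stateAfter B C π x k)) =
      Fintype.card (Fin m → Equiv.Perm (Fin n) × Equiv.Perm (Fin n)) *
        (fun g => kernel B (kernel C g))^[k] f (hammingNorm (repetitionMatrix 2 n *ᵥ x)) := by
  induction k using Fin.induction generalizing f with
  | zero => simp [stateAfter_zero]
  | succ k ih =>
    set G := Equiv.Perm (Fin n) × Equiv.Perm (Fin n)
    have hG : (Fintype.card G : ℝ) ≠ 0 := by exact_mod_cast Fintype.card_ne_zero
    rw [Fin.val_succ, Function.iterate_succ_apply]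
    have := ih (kernel B (kernel C f))
    rw [Fin.val_castSucc] at this
    rw [← this]
    apply mul_left_cancel₀ hG
    rw [Finset.mul_sum (s := Finset.univ) (f := fun π : Fin m → G => kernel B (kernel C f) _),
      ← Finset.sum_congr rfl fun π _ => sum_roundMap_eq_kernel B C f (stateAfter B C π x k.castSucc)]
    -- Multiplying coordinate `k` by `q` permutes the sample space and does not affect the earlier
    -- state. Averaging over `q` resamples round `k` independently of the past.
    have h1 : ∀ q : G, ∑ π : Fin m → G, f (hammingNorm (stateAfter B C π x k.succ)) =
        ∑ π : Fin m → G, f (hammingNorm (roundMap B C (π k * q) (stateAfter B C π x k.castSucc))) := by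
      intro q
      rw [← Equiv.sum_comp (Equiv.mulRight (Pi.mulSingle k q : Fin m → G))]
      refine Finset.sum_congr rfl fun π _ => ?_
      rw [stateAfter_succ, stateAfter_congr B C (π' := π) x k.castSucc]
      · simp
      · intro i hi
        simp [Pi.mulSingle_eq_of_ne (show i ≠ k by rintro rfl; exact lt_irrefl _ hi)]
    calc (Fintype.card G : ℝ) * ∑ π : Fin m → G, f (hammingNorm (stateAfter B C π x k.succ))
        = ∑ q : G, ∑ π : Fin m → G,
            f (hammingNorm (roundMap B C (π k * q) (stateAfter B C π x k.castSucc))) := by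
          rw [← Finset.sum_congr rfl fun q _ => h1 q, Finset.sum_const, nsmul_eq_mul,
            Finset.card_univ]
      _ = _ := by
          rw [Finset.sum_comm]
          exact Finset.sum_congr rfl fun π _ => Equiv.sum_comp (Equiv.mulLeft (π k))
            fun p => f (hammingNorm (roundMap B C p (stateAfter B C π x k.castSucc)))

theorem hammingNorm_repetition {n : ℕ} (x : Fin (n / 2) → ZMod 2) :
    hammingNorm (repetitionMatrix 2 n *ᵥ x) = 2 * hammingNorm x := by
  have h1 : ∀ i : Fin n, (repetitionMatrix 2 n *ᵥ x) i =
      if h : (i : ℕ) / 2 < n / 2 then x ⟨i / 2, h⟩ else 0 := by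
    intro i
    simp only [Matrix.mulVec, dotProduct, repetitionMatrix, Matrix.of_apply, ite_mul, one_mul,
      zero_mul]
    split_ifs with h
    · rw [Finset.sum_eq_single ⟨i / 2, h⟩]
      · simp
      · intro j _ hj
        rw [if_neg]
        intro h'
        exact hj (Fin.ext h'.symm)
      · simp
    · exact Finset.sum_eq_zero fun j _ => if_neg (by have := j.2; omega)
  set F : ℕ → ℕ := fun j => if h : j < n / 2 then (if x ⟨j, h⟩ = 0 then 0 else 1) else 0 with hF
  have hx : hammingNorm x = ∑ j ∈ Finset.range (n / 2), F j := by
    rw [hammingNorm_eq_sum, ← Fin.sum_univ_eq_sum_range]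
    exact Finset.sum_congr rfl fun j _ => by simp [hF]
  have hR : hammingNorm (repetitionMatrix 2 n *ᵥ x) = ∑ i ∈ Finset.range n, F (i / 2) := by
    rw [hammingNorm_eq_sum, ← Fin.sum_univ_eq_sum_range fun i => F (i / 2)]
    refine Finset.sum_congr rfl fun i _ => ?_
    rw [h1, hF]
    by_cases h : (i : ℕ) / 2 < n / 2
    · simp [h]
    · simp [h]
  have hsum : ∀ q, ∑ i ∈ Finset.range (2 * q), F (i / 2) = 2 * ∑ j ∈ Finset.range q, F j := by
    intro q
    induction q with
    | zero => simp
    | succ q ih =>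
      rw [show 2 * (q + 1) = 2 * q + 1 + 1 by ring, Finset.sum_range_succ, Finset.sum_range_succ, ih,
        Finset.sum_range_succ, show 2 * q / 2 = q by omega, show (2 * q + 1) / 2 = q by omega]
      ring
  rw [hR, hx, ← hsum]
  rcases Nat.even_or_odd' n with ⟨q, hq | hq⟩
  · rw [show 2 * (n / 2) = n by omega]
  -- For odd `n` the last coordinate repeats no message bit and is zero.
  · have h2 : F (n / 2) = 0 := by simp [hF]
    conv_lhs => rw [show n = 2 * (n / 2) + 1 by omega]
    rw [Finset.sum_range_succ, show 2 * (n / 2) / 2 = n / 2 by omega, h2, add_zero]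

/-! ### Expected number of messages mapped to a given vector -/

/-- The pairing of a density on weights (per vector) with a function of the weight. -/
def pairing (n : ℕ) (u f : ℕ → ℝ) : ℝ := ∑ w ∈ Finset.range (n + 1), n.choose w * u w * f w

/-- The total mass of the density `u` on the vectors whose weight is within `L` of `0` or `n`. -/
def edgeMass (n L : ℕ) (u : ℕ → ℝ) : ℝ :=
  ∑ w ∈ (Finset.range (n + 1)).filter (Edge n L), n.choose w * u w

/-- The effect on densities of a random permutation followed by the accumulator. -/
def stepA (n : ℕ) (u : ℕ → ℝ) (b : ℕ) : ℝ :=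
  (∑ a ∈ Finset.range (n + 1), u a * accCount n a b) / n.choose b

/-- The effect on densities of a random permutation followed by the discrete derivative. -/
def stepD (n : ℕ) (u : ℕ → ℝ) (b : ℕ) : ℝ :=
  (∑ a ∈ Finset.range (n + 1), u a * accCount n b a) / n.choose b

/-- The density of the repeated nonzero messages. -/
def initialDensity (n w : ℕ) : ℝ :=
  if w ≠ 0 ∧ Even w then ((n / 2).choose (w / 2) : ℝ) / n.choose w else 0

theorem choose_cast_pos {n b : ℕ} (hb : b ≤ n) : (0 : ℝ) < n.choose b := by
  exact_mod_cast Nat.choose_pos hb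

/-- Adjointness: pulling a test function back through a random step equals pushing the density
forward. -/
theorem pairing_kernel {n : ℕ} (M : Matrix (Fin n) (Fin n) (ZMod 2)) (u f : ℕ → ℝ) :
    pairing n u (kernel M f) = pairing n
      (fun b => (∑ a ∈ Finset.range (n + 1), u a * weightCount M a b) / n.choose b) f := by
  have h1 : ∀ w ∈ Finset.range (n + 1), n.choose w * u w * kernel M f w =
      ∑ b ∈ Finset.range (n + 1), u w * weightCount M w b * f b := by
    intro w hw
    have := (choose_cast_pos (Nat.lt_succ_iff.mp (Finset.mem_range.mp hw))).ne'
    rw [kernel, mul_div_assoc', div_eq_iff this, Finset.mul_sum, Finset.sum_mul]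
    exact Finset.sum_congr rfl fun b _ => by ring
  have h2 : ∀ b ∈ Finset.range (n + 1), n.choose b *
      ((∑ a ∈ Finset.range (n + 1), u a * weightCount M a b) / n.choose b) * f b =
      ∑ w ∈ Finset.range (n + 1), u w * weightCount M w b * f b := by
    intro b hb
    have := (choose_cast_pos (Nat.lt_succ_iff.mp (Finset.mem_range.mp hb))).ne'
    rw [mul_div_cancel₀ _ this, Finset.sum_mul]
  rw [pairing, pairing, Finset.sum_congr rfl h1, Finset.sum_congr rfl h2, Finset.sum_comm]

theorem pairing_kernel_acc (t : Bool) (n : ℕ) (u f : ℕ → ℝ) :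
    pairing n u (kernel (orient t (accMatrix n)) f) = pairing n (stepA n u) f := by
  simp only [pairing_kernel, weightCount_orient_acc]
  rfl

theorem pairing_kernel_deriv (t : Bool) (n : ℕ) (u f : ℕ → ℝ) :
    pairing n u (kernel (orient t (derivMatrix n)) f) = pairing n (stepD n u) f := by
  simp only [pairing_kernel, weightCount_orient_deriv]
  rfl

theorem pairing_iterate {n : ℕ} {K P : (ℕ → ℝ) → ℕ → ℝ}
    (h : ∀ u f, pairing n u (K f) = pairing n (P u) f) (k : ℕ) (u f : ℕ → ℝ) :
    pairing n u (K^[k] f) = pairing n (P^[k] u) f := by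
  induction k generalizing u with
  | zero => rfl
  | succ k ih => rw [Function.iterate_succ_apply', h, ih, Function.iterate_succ_apply]

theorem pairing_indicator (n L : ℕ) (u : ℕ → ℝ) :
    pairing n u (fun b => if Edge n L b then 1 else 0) = edgeMass n L u := by
  simp only [pairing, edgeMass, Finset.sum_filter, mul_ite, mul_one, mul_zero]

theorem sum_repetition_eq_pairing {n : ℕ} (F : ℕ → ℝ) :
    ∑ x ∈ Finset.univ.filter (fun x : Fin (n / 2) → ZMod 2 => x ≠ 0),
        F (hammingNorm (repetitionMatrix 2 n *ᵥ x)) = pairing n (initialDensity n) F := by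
  simp only [hammingNorm_repetition]
  rw [← Finset.sum_fiberwise_of_maps_to (g := fun x => hammingNorm x)
    (t := (Finset.range (n / 2 + 1)).filter (· ≠ 0))]
  · have hP : pairing n (initialDensity n) F =
        ∑ w ∈ (Finset.range (n + 1)).filter (fun w => w ≠ 0 ∧ Even w),
          ((n / 2).choose (w / 2) : ℝ) * F w := by
      rw [pairing, Finset.sum_filter]
      refine Finset.sum_congr rfl fun w hw => ?_
      have := (choose_cast_pos (Nat.lt_succ_iff.mp (Finset.mem_range.mp hw))).ne'
      simp only [initialDensity]
      split_ifs
      · rw [mul_div_cancel₀ _ this]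
      · simp
    rw [hP]
    refine Finset.sum_bij' (fun j _ => 2 * j) (fun w _ => w / 2) ?_ ?_ ?_ ?_ ?_
    · intro j hj
      simp only [Finset.mem_filter, Finset.mem_range] at hj ⊢
      exact ⟨by omega, by omega, even_two_mul j⟩
    · intro w hw
      simp only [Finset.mem_filter, Finset.mem_range] at hw ⊢
      obtain ⟨h1, h2, k, rfl⟩ := hw
      exact ⟨by omega, by omega⟩
    · intro j _; simp
    · intro w hw
      simp only [Finset.mem_filter, Finset.mem_range] at hw
      obtain ⟨h1, h2, k, rfl⟩ := hw
      omega
    · intro j hj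
      simp only [Finset.mem_filter, Finset.mem_range] at hj
      rw [Finset.sum_congr rfl (g := fun _ => F (2 * j))
        (fun x hx => by rw [(Finset.mem_filter.mp hx).2]), Finset.sum_const, nsmul_eq_mul,
        show 2 * j / 2 = j by omega, ← card_hammingNorm_eq, Finset.filter_filter]
      congr 3
      refine Finset.filter_congr fun x _ => ⟨fun h => h.2, fun h => ⟨?_, h⟩⟩
      rw [← hammingNorm_ne_zero_iff, h]
      exact hj.2
  · intro x hx
    have := hammingNorm_le x
    simp only [Finset.mem_filter, Finset.mem_univ, true_and, Finset.mem_range] at hx ⊢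
    exact ⟨by omega, hammingNorm_ne_zero_iff.mpr hx⟩

/-- The bound on the final weight is discarded here, so `d` plays no further role. -/
theorem edgeCount_le {n m : ℕ} (B C : Matrix (Fin n) (Fin n) (ZMod 2)) {h : ℝ} (d : ℝ) {L : ℕ}
    (hL : h ≤ L) (π : Fin m → Equiv.Perm (Fin n) × Equiv.Perm (Fin n)) :
    (edgeCount B C h d π : ℝ) ≤ ∑ x ∈ Finset.univ.filter (fun x : Fin (n / 2) → ZMod 2 => x ≠ 0),
      if Edge n L (hammingNorm (stateAfter B C π x ⟨m - 1, by omega⟩)) then (1 : ℝ) else 0 := by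
  rw [Finset.sum_boole, edgeCount, Finset.filter_filter, ← Set.ncard_coe_finset, Nat.cast_le]
  refine Set.ncard_le_ncard ?_ (Finset.finite_toSet _)
  rintro x ⟨hx, hw, -⟩
  simp only [Finset.coe_filter, Finset.mem_univ, true_and, Set.mem_ofPred_eq]
  refine ⟨hx, ?_⟩
  rcases hw with hw | hw
  · left
    exact_mod_cast hw.trans hL
  · right
    have : (n : ℝ) ≤ hammingNorm (stateAfter B C π x ⟨m - 1, by omega⟩) + L := by linarith
    exact_mod_cast this

theorem expectedEdgeCount_le {n : ℕ} (m : ℕ) (B C : Matrix (Fin n) (Fin n) (ZMod 2)) {h : ℝ} (d : ℝ)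
    {L : ℕ} (hL : h ≤ L) :
    expectedEdgeCount m n B C h d ≤ pairing n (initialDensity n)
      ((fun g => kernel B (kernel C g))^[m - 1] fun b => if Edge n L b then 1 else 0) := by
  have hG : (0 : ℝ) < Fintype.card (Fin m → Equiv.Perm (Fin n) × Equiv.Perm (Fin n)) := by
    exact_mod_cast Fintype.card_pos
  rw [expectedEdgeCount, div_le_iff₀ hG, ← sum_repetition_eq_pairing, Finset.sum_mul]
  refine (Finset.sum_le_sum fun π _ => edgeCount_le B C d hL π).trans ?_
  rw [Finset.sum_comm]
  refine Finset.sum_le_sum fun x _ => ?_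
  rw [sum_stateAfter_eq_kernel B C x ⟨m - 1, by omega⟩ fun b => if Edge n L b then (1 : ℝ) else 0,
    mul_comm]

theorem starDA_le (t : Bool) (ε : ℝ) (m : ℕ) {n L : ℕ} (hL : edgeWidth n ≤ L) :
    starDA t ε m n ≤ edgeMass n L ((fun u => stepA n (stepD n u))^[m - 1] (initialDensity n)) := by
  refine (expectedEdgeCount_le m _ _ _ hL).trans ?_
  rw [pairing_iterate (P := fun u => stepA n (stepD n u)), pairing_indicator]
  intro u f
  rw [pairing_kernel_deriv, pairing_kernel_acc]

theorem starAD_le (t : Bool) (ε : ℝ) (m : ℕ) {n L : ℕ} (hL : edgeWidth n ≤ L) :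
    starAD t ε m n ≤ edgeMass n L ((fun u => stepD n (stepA n u))^[m - 1] (initialDensity n)) := by
  refine (expectedEdgeCount_le m _ _ _ hL).trans ?_
  rw [pairing_iterate (P := fun u => stepD n (stepA n u)), pairing_indicator]
  intro u f
  rw [pairing_kernel_acc, pairing_kernel_deriv]

theorem expectedEdgeCount_nonneg (m n : ℕ) (B C : Matrix (Fin n) (Fin n) (ZMod 2)) (h d : ℝ) :
    0 ≤ expectedEdgeCount m n B C h d :=
  div_nonneg (Finset.sum_nonneg fun _ _ => Nat.cast_nonneg _) (Nat.cast_nonneg _)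

/-! ### Densities and their behaviour under one step -/

/-- A density on vectors that gives no mass to the zero vector. -/
structure IsDensity (n : ℕ) (v : ℕ → ℝ) : Prop where
  nonneg : ∀ w, 0 ≤ v w
  le_one : ∀ w, w ≤ n → v w ≤ 1
  zero : v 0 = 0

theorem stepA_nonneg {n : ℕ} {v : ℕ → ℝ} (hv : ∀ w, 0 ≤ v w) (b : ℕ) : 0 ≤ stepA n v b :=
  div_nonneg (Finset.sum_nonneg fun a _ => mul_nonneg (hv a) (Nat.cast_nonneg _)) (Nat.cast_nonneg _)

theorem stepD_nonneg {n : ℕ} {v : ℕ → ℝ} (hv : ∀ w, 0 ≤ v w) (b : ℕ) : 0 ≤ stepD n v b :=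
  div_nonneg (Finset.sum_nonneg fun a _ => mul_nonneg (hv a) (Nat.cast_nonneg _)) (Nat.cast_nonneg _)

theorem mul_natCast_le_of_ne_zero {x y : ℝ} {c : ℕ} (h : c ≠ 0 → x ≤ y) : x * c ≤ y * c := by
  rcases eq_or_ne c 0 with rfl | hc
  · simp
  · exact mul_le_mul_of_nonneg_right (h hc) (Nat.cast_nonneg _)

/-- As `A` is a bijection, the weights `accCount n a b / n.choose b` sum to one over `a`. A step is
therefore an average over its possible sources. -/
theorem stepA_le {n b : ℕ} {v : ℕ → ℝ} {y : ℝ} (hb : b ≤ n)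
    (h : ∀ a, a ≤ n → accCount n a b ≠ 0 → v a ≤ y) : stepA n v b ≤ y := by
  rw [stepA, div_le_iff₀ (choose_cast_pos hb), ← sum_accCount_left n b, Nat.cast_sum,
    Finset.mul_sum]
  exact Finset.sum_le_sum fun a ha => mul_natCast_le_of_ne_zero
    (h a (Nat.lt_succ_iff.mp (Finset.mem_range.mp ha)))

theorem stepD_le {n b : ℕ} {v : ℕ → ℝ} {y : ℝ} (hb : b ≤ n)
    (h : ∀ a, a ≤ n → accCount n b a ≠ 0 → v a ≤ y) : stepD n v b ≤ y := by
  rw [stepD, div_le_iff₀ (choose_cast_pos hb), ← sum_accCount n b, Nat.cast_sum,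
    Finset.mul_sum]
  exact Finset.sum_le_sum fun a ha => mul_natCast_le_of_ne_zero
    (h a (Nat.lt_succ_iff.mp (Finset.mem_range.mp ha)))

theorem IsDensity.stepA {n : ℕ} {v : ℕ → ℝ} (hv : IsDensity n v) : IsDensity n (stepA n v) where
  nonneg := stepA_nonneg hv.nonneg
  le_one _ hw := stepA_le hw fun a ha _ => hv.le_one a ha
  zero := le_antisymm (stepA_le (Nat.zero_le n) fun a _ ha => by
      have : a = 0 := by_contra fun h => ha (accCount_zero_right h)
      rw [this, hv.zero]) (stepA_nonneg hv.nonneg 0)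

theorem IsDensity.stepD {n : ℕ} {v : ℕ → ℝ} (hv : IsDensity n v) : IsDensity n (stepD n v) where
  nonneg := stepD_nonneg hv.nonneg
  le_one _ hw := stepD_le hw fun a ha _ => hv.le_one a ha
  zero := le_antisymm (stepD_le (Nat.zero_le n) fun a _ ha => by
      have : a = 0 := by_contra fun h => ha (accCount_zero_left h)
      rw [this, hv.zero]) (stepD_nonneg hv.nonneg 0)

/-- The probability that a random permutation followed by the accumulator takes weight `a` to
within `L` of an end of the weight range. -/
def edgeProb (n L a : ℕ) : ℝ :=
  (∑ b ∈ (Finset.range (n + 1)).filter (Edge n L), (accCount n a b : ℝ)) / n.choose a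

theorem edgeProb_nonneg (n L a : ℕ) : 0 ≤ edgeProb n L a :=
  div_nonneg (Finset.sum_nonneg fun _ _ => Nat.cast_nonneg _) (Nat.cast_nonneg _)

theorem edgeProb_le_one {n L a : ℕ} (ha : a ≤ n) : edgeProb n L a ≤ 1 := by
  rw [edgeProb, div_le_one (choose_cast_pos ha), ← sum_accCount n a, Nat.cast_sum]
  exact Finset.sum_le_sum_of_subset_of_nonneg (Finset.filter_subset _ _)
    fun _ _ _ => Nat.cast_nonneg _

theorem edgeProb_eq_zero {n L a : ℕ} (ha : 2 * L + 1 < a) : edgeProb n L a = 0 := by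
  rw [edgeProb, Finset.sum_eq_zero, zero_div]
  intro b hb
  by_contra h
  obtain ⟨h1, h2, h3⟩ := le_of_accCount_ne_zero (by omega) (Nat.cast_ne_zero.mp h)
  rcases (Finset.mem_filter.mp hb).2 with hb | hb <;> omega

/-- About `n ^ (a / 2)` favourable vectors are compared with `n.choose a ≥ (n / a) ^ a`; what
remains is `n` to the power `-⌈a/2⌉`. Since `a ≠ 0`, constant factors fit into the `a`-th power. -/
theorem edgeProb_mul_pow_le {n L a : ℕ} (ha : a ≠ 0) (hn : 2 * (2 * L + 1) ≤ n) :
    edgeProb n L a * n ^ ((a + 1) / 2) ≤ (2 * (L + 1) * (L + 1) * (2 * L + 1)) ^ a := by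
  rcases lt_or_ge (2 * L + 1) a with h | h
  · rw [edgeProb_eq_zero h, zero_mul]; positivity
  have han : a ≤ n := by omega
  rw [edgeProb, div_mul_eq_mul_div, div_le_iff₀ (choose_cast_pos han)]
  have h1 : ∑ b ∈ (Finset.range (n + 1)).filter (Edge n L), accCount n a b ≤
      2 * (L + 1) * (n ^ (a / 2) * (L + 1) ^ a) := by
    refine (Finset.sum_le_card_nsmul _ _ _ fun b hb =>
      accCount_le_of_edge ha (Finset.mem_filter.mp hb).2).trans ?_
    rw [smul_eq_mul]
    exact Nat.mul_le_mul_right _ (card_edge_le n L)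
  have h2 : n ^ a ≤ (2 * L + 1) ^ a * n.choose a := by
    refine (pow_le_pow_mul_choose han).trans (Nat.mul_le_mul_right _ (Nat.pow_le_pow_left h a))
  have h3 : 2 * (L + 1) ≤ (2 * (L + 1)) ^ a := Nat.le_self_pow ha _
  have h4 : (∑ b ∈ (Finset.range (n + 1)).filter (Edge n L), accCount n a b) * n ^ ((a + 1) / 2) ≤
      (2 * (L + 1) * (L + 1) * (2 * L + 1)) ^ a * n.choose a := by
    calc _ ≤ 2 * (L + 1) * (n ^ (a / 2) * (L + 1) ^ a) * n ^ ((a + 1) / 2) :=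
          Nat.mul_le_mul_right _ h1
      _ = 2 * (L + 1) * (L + 1) ^ a * n ^ (a / 2 + (a + 1) / 2) := by rw [pow_add]; ring
      _ = 2 * (L + 1) * (L + 1) ^ a * n ^ a := by rw [show a / 2 + (a + 1) / 2 = a by omega]
      _ ≤ (2 * (L + 1)) ^ a * (L + 1) ^ a * ((2 * L + 1) ^ a * n.choose a) :=
          Nat.mul_le_mul (Nat.mul_le_mul_right _ h3) h2
      _ = _ := by simp only [mul_pow]; ring
  exact_mod_cast h4

/-- Raising `i` by two costs `x ^ 2` and gains `y`, so `x ^ i / y ^ ⌈i/2⌉` never exceeds `x ^ 2 /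
y`. This removes the dependence on the weight from the polylogarithmic factors. -/
theorem pow_le_sq_mul_pow {x y : ℝ} {i : ℕ} (hx : 1 ≤ x) (hxy : x ^ 2 ≤ y) (hi : i ≠ 0) :
    x ^ i * y ≤ x ^ 2 * y ^ ((i + 1) / 2) := by
  obtain ⟨j, hj⟩ : ∃ j, (i + 1) / 2 = j + 1 := ⟨(i + 1) / 2 - 1, by omega⟩
  have hy : 0 ≤ y := (sq_nonneg x).trans hxy
  calc x ^ i * y ≤ x ^ (2 * (j + 1)) * y :=
        mul_le_mul_of_nonneg_right (pow_le_pow_right₀ hx (by omega)) hy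
    _ = x ^ 2 * ((x ^ 2) ^ j * y) := by rw [← pow_mul]; ring
    _ ≤ x ^ 2 * (y ^ j * y) := by gcongr
    _ = _ := by rw [hj, pow_succ y]

theorem edgeProb_mul_le {n L a : ℕ} (ha : a ≠ 0)
    (hn : (2 * (L + 1) * (L + 1) * (2 * L + 1)) ^ 2 ≤ n) :
    edgeProb n L a * n ≤ (2 * (L + 1) * (L + 1) * (2 * L + 1)) ^ 2 := by
  set Q := 2 * (L + 1) * (L + 1) * (2 * L + 1) with hQ
  have hQ1 : 2 * (2 * L + 1) ≤ Q := by rw [hQ]; nlinarith [Nat.zero_le (L * L)]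
  have hQ2 : Q ≤ Q ^ 2 := Nat.le_self_pow two_ne_zero Q
  have h := edgeProb_mul_pow_le ha (hQ1.trans (hQ2.trans hn))
  have hQ' : (2 * ((L : ℝ) + 1) * (L + 1) * (2 * L + 1)) = Q := by rw [hQ]; push_cast; ring
  rw [hQ'] at h ⊢
  have hn0 : (0 : ℝ) < n := by
    have : 0 < n := by omega
    exact_mod_cast this
  have hle := pow_le_sq_mul_pow (x := (Q : ℝ)) (y := n) (i := a)
    (by exact_mod_cast (by omega : 1 ≤ Q)) (by exact_mod_cast hn) ha
  have hpos : (0 : ℝ) < (n : ℝ) ^ ((a + 1) / 2) := by positivity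
  refine le_of_mul_le_mul_right ?_ hpos
  calc edgeProb n L a * n * n ^ ((a + 1) / 2) = edgeProb n L a * n ^ ((a + 1) / 2) * n := by ring
    _ ≤ Q ^ a * n := mul_le_mul_of_nonneg_right h hn0.le
    _ ≤ _ := hle

theorem edgeMass_stepA (n L : ℕ) (v : ℕ → ℝ) :
    edgeMass n L (stepA n v) = ∑ a ∈ Finset.range (n + 1), n.choose a * v a * edgeProb n L a := by
  have h1 : ∀ b ∈ (Finset.range (n + 1)).filter (Edge n L), n.choose b * stepA n v b =
      ∑ a ∈ Finset.range (n + 1), v a * accCount n a b := by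
    intro b hb
    rw [stepA, mul_div_cancel₀ _ (choose_cast_pos (Nat.lt_succ_iff.mp
      (Finset.mem_range.mp (Finset.mem_filter.mp hb).1))).ne']
  rw [edgeMass, Finset.sum_congr rfl h1, Finset.sum_comm]
  refine Finset.sum_congr rfl fun a ha => ?_
  have := (choose_cast_pos (Nat.lt_succ_iff.mp (Finset.mem_range.mp ha))).ne'
  rw [edgeProb, ← Finset.mul_sum]
  field_simp

theorem edgeMass_stepA_stepD (n L : ℕ) (v : ℕ → ℝ) :
    edgeMass n L (stepA n (stepD n v)) = ∑ w ∈ Finset.range (n + 1),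
      ∑ a ∈ Finset.range (n + 1), v w * accCount n a w * edgeProb n L a := by
  rw [edgeMass_stepA, Finset.sum_comm]
  refine Finset.sum_congr rfl fun a ha => ?_
  rw [stepD, mul_div_cancel₀ _ (choose_cast_pos (Nat.lt_succ_iff.mp (Finset.mem_range.mp ha))).ne',
    Finset.sum_mul]

theorem edgeMass_stepD (n L : ℕ) (v : ℕ → ℝ) :
    edgeMass n L (stepD n v) = ∑ a ∈ Finset.range (n + 1),
      ∑ b ∈ (Finset.range (n + 1)).filter (Edge n L), v a * accCount n b a := by
  rw [edgeMass, Finset.sum_comm]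
  refine Finset.sum_congr rfl fun b hb => ?_
  rw [stepD, mul_div_cancel₀ _ (choose_cast_pos (Nat.lt_succ_iff.mp
      (Finset.mem_range.mp (Finset.mem_filter.mp hb).1))).ne']

theorem sum_range_le_of_support {f : ℕ → ℝ} {N k : ℕ} {y : ℝ} (hy : 0 ≤ y)
    (h1 : ∀ w, w < N → w ≤ k → f w ≤ y) (h2 : ∀ w, w < N → k < w → f w = 0) :
    ∑ w ∈ Finset.range N, f w ≤ (k + 1) * y := by
  calc ∑ w ∈ Finset.range N, f w ≤ ∑ w ∈ Finset.range N, if w ∈ Finset.range (k + 1) then y else 0 := by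
        refine Finset.sum_le_sum fun w hw => ?_
        rw [Finset.mem_range] at hw
        split_ifs with h
        · exact h1 w hw (Nat.lt_succ_iff.mp (Finset.mem_range.mp h))
        · exact (h2 w hw (by simpa using h)).le
    _ = ∑ w ∈ (Finset.range N).filter (· ∈ Finset.range (k + 1)), y := by rw [Finset.sum_filter]
    _ ≤ ∑ w ∈ Finset.range (k + 1), y := by
        refine Finset.sum_le_sum_of_subset_of_nonneg (fun w hw => (Finset.mem_filter.mp hw).2)
          fun _ _ _ => hy
    _ = (k + 1) * y := by simp

/-! ### Polylogarithmic bounds -/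

/-- An integer version of the binary logarithm. -/
def lam (n : ℕ) : ℕ := Nat.log 2 n + 1

theorem lt_two_pow_lam (n : ℕ) : n < 2 ^ lam n := Nat.lt_pow_succ_log_self one_lt_two n

theorem logb_le_lam (n : ℕ) : Real.logb 2 n ≤ lam n := by
  rcases Nat.eq_zero_or_pos n with rfl | hn
  · simp
  · rw [Real.logb_le_iff_le_rpow one_lt_two (by exact_mod_cast hn), Real.rpow_natCast]
    exact_mod_cast (lt_two_pow_lam n).le

theorem lam_le_two_mul_logb {n : ℕ} (hn : 2 ≤ n) : (lam n : ℝ) ≤ 2 * Real.logb 2 n := by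
  have h1 : (Nat.log 2 n : ℝ) ≤ Real.logb 2 n := Real.natLog_le_logb n 2
  have h2 : (1 : ℝ) ≤ Real.logb 2 n := by
    rw [Real.le_logb_iff_rpow_le one_lt_two (by positivity), Real.rpow_one]
    exact_mod_cast hn
  rw [lam]
  push_cast
  linarith

theorem eventually_le_lam (C : ℕ) : ∀ᶠ n in evenAtTop, C ≤ lam n := by
  refine Eventually.filter_mono inf_le_left ?_
  filter_upwards [eventually_ge_atTop (2 ^ C)] with n hn
  exact (Nat.le_log_of_pow_le one_lt_two hn).trans (Nat.le_succ _)

theorem eventually_lam_pow_le (c : ℕ) : ∀ᶠ n in evenAtTop, lam n ^ c ≤ n := by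
  refine Eventually.filter_mono inf_le_left ?_
  have h1 : (fun x : ℝ => Real.log x ^ c) =o[atTop] fun x => x :=
    Real.isLittleO_pow_log_id_atTop
  have h2 := (h1.def (c := (4 ^ c)⁻¹) (by positivity)).filter_mono tendsto_natCast_atTop_atTop
  rw [eventually_map] at h2
  filter_upwards [h2, eventually_ge_atTop 2] with n hn hn2
  have hlog : 0 ≤ Real.log n := Real.log_natCast_nonneg n
  rw [Real.norm_of_nonneg (by positivity), Real.norm_of_nonneg (by positivity)] at hn
  have h3 : (lam n : ℝ) ≤ 4 * Real.log n := by
    refine (lam_le_two_mul_logb hn2).trans ?_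
    rw [Real.logb, mul_div_assoc', div_le_iff₀ (Real.log_pos one_lt_two)]
    nlinarith [Real.log_two_gt_d9]
  have h4 : (lam n : ℝ) ^ c ≤ n := by
    calc (lam n : ℝ) ^ c ≤ (4 * Real.log n) ^ c := by gcongr
      _ = 4 ^ c * Real.log n ^ c := mul_pow _ _ _
      _ ≤ 4 ^ c * ((4 ^ c)⁻¹ * n) := by gcongr
      _ = n := by field_simp
  exact_mod_cast h4

theorem eventually_even : ∀ᶠ n in evenAtTop, Even n :=
  mem_inf_of_right (mem_principal_self _)

/-- In binary the polynomial factors and `n ^ (2 * lam n ^ c + 1)` need about `lam n ^ (c + 1)`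
bits, one power of `lam n` less than is available. -/
theorem eventually_mul_half_pow_le (c K : ℕ) : ∀ᶠ n : ℕ in evenAtTop,
    ((n : ℝ) + 1) ^ 2 * n ^ (2 * lam n ^ c + 1) * (1 / 2) ^ lam n ^ (c + 2) ≤ 1 / n ^ K := by
  filter_upwards [eventually_le_lam (5 + K), eventually_lam_pow_le 1] with n h5 hn
  have hlam : 1 ≤ lam n := by omega
  have hn0 : (0 : ℝ) < n := by
    rw [pow_one] at hn
    exact_mod_cast hlam.trans hn
  have hL : 1 ≤ lam n ^ c := Nat.one_le_pow _ _ hlam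
  rw [le_div_iff₀ (by positivity), div_pow, one_pow, mul_one_div, div_mul_eq_mul_div,
    div_le_one (by positivity)]
  have hexp : lam n * (2 * lam n ^ c + 3 + K) ≤ lam n ^ (c + 2) := by
    calc lam n * (2 * lam n ^ c + 3 + K) ≤ lam n * (lam n ^ c * lam n) := by
          refine Nat.mul_le_mul_left _ ?_
          nlinarith [Nat.mul_le_mul_left (lam n ^ c) h5, Nat.mul_le_mul_right K hL]
      _ = _ := by ring
  have h1 : n + 1 ≤ 2 ^ lam n := lt_two_pow_lam n
  have h2 : (n + 1) ^ 2 * n ^ (2 * lam n ^ c + 1) * n ^ K ≤ 2 ^ lam n ^ (c + 2) := by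
    calc _ ≤ (2 ^ lam n) ^ 2 * (2 ^ lam n) ^ (2 * lam n ^ c + 1) * (2 ^ lam n) ^ K := by
          have h3 : n ≤ 2 ^ lam n := by omega
          gcongr
      _ = 2 ^ (lam n * (2 * lam n ^ c + 3 + K)) := by
          rw [← pow_add, ← pow_add, ← pow_mul]; ring_nf
      _ ≤ _ := Nat.pow_le_pow_right two_pos hexp
  exact_mod_cast h2

/-! ### Densities that are negligible away from the ends of the weight range -/

/-- The densities `u n` decay faster than any quasipolynomial in `n` outside polylogarithmic
neighbourhoods of the ends of the weight range. -/
def SmallMiddle (u : ℕ → ℕ → ℝ) : Prop :=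
  ∀ c, ∃ c', ∀ᶠ n in evenAtTop, ∀ w, w ≤ n → ¬ Edge n (lam n ^ c') w → u n w ≤ (1 / 2) ^ lam n ^ c

/-- Near the ends of the weight range, `u n w` is at most about `n ^ (-i / 2)`, where `i` is the
distance of `w` to the nearer end. -/
def SmallEnds (u : ℕ → ℕ → ℝ) : Prop :=
  ∀ c, ∃ c', ∀ᶠ n in evenAtTop, ∀ w, w ≤ n → w ≠ 0 → endDist n w ≤ lam n ^ c →
    u n w * n ^ ((endDist n w + 1) / 2) ≤ (lam n ^ c') ^ endDist n w

/-- A source within `L` of an end would force `b ≤ 2 * L + 1`, so a middle value averages middle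
values only. -/
theorem SmallMiddle.stepD {u : ℕ → ℕ → ℝ} (hu : SmallMiddle u) :
    SmallMiddle fun n => stepD n (u n) := by
  intro c
  obtain ⟨c', h⟩ := hu c
  refine ⟨c' + 2, ?_⟩
  filter_upwards [h, eventually_le_lam 2] with n h h2 b hb hmid
  refine stepD_le hb fun a ha hne => h a ha fun hedge => hmid ?_
  have hL : 1 ≤ lam n ^ c' := Nat.one_le_pow _ _ (by omega)
  have hL' : 4 * lam n ^ c' ≤ lam n ^ (c' + 2) := by
    rw [pow_add, mul_comm]
    exact Nat.mul_le_mul_left _ (Nat.pow_le_pow_left h2 2)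
  have hb0 : b ≠ 0 := by
    rintro rfl
    exact hmid (Or.inl (Nat.zero_le _))
  obtain ⟨h3, h4, h5⟩ := le_of_accCount_ne_zero hb0 hne
  left
  rcases hedge with h6 | h6 <;> omega

/-- Middle sources are averaged. Sources near the ends are at most `2 * (L + 1) * n ^ L` vectors of
density at most one, negligible against `n.choose b ≥ 2 ^ endDist n b`. -/
theorem SmallMiddle.stepA {u : ℕ → ℕ → ℝ} (hd : ∀ n, IsDensity n (u n)) (hu : SmallMiddle u) :
    SmallMiddle fun n => stepA n (u n) := by
  intro c
  obtain ⟨c₁, h⟩ := hu (c + 1)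
  refine ⟨c₁ + c + 2, ?_⟩
  filter_upwards [h, eventually_le_lam 5] with n h h5 b hb hmid
  have hC := choose_cast_pos hb
  set L := lam n ^ c₁ with hL
  have hL1 : 1 ≤ L := Nat.one_le_pow _ _ (by omega)
  have hc1 : 1 ≤ lam n ^ c := Nat.one_le_pow _ _ (by omega)
  have hsum : ∑ a ∈ Finset.range (n + 1), u n a * accCount n a b ≤
      (1 / 2) ^ lam n ^ (c + 1) * n.choose b + (2 * (L + 1)) * n ^ L := by
    rw [← Finset.sum_filter_not_add_sum_filter _ (Edge n L)]
    refine add_le_add ?_ ?_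
    · rw [← sum_accCount_left n b, Nat.cast_sum, Finset.mul_sum]
      refine (Finset.sum_le_sum fun a ha => ?_).trans
        (Finset.sum_le_sum_of_subset_of_nonneg (Finset.filter_subset _ _)
          fun _ _ _ => by positivity)
      rw [Finset.mem_filter, Finset.mem_range] at ha
      exact mul_le_mul_of_nonneg_right (h a (by omega) ha.2) (Nat.cast_nonneg _)
    · have hterm : ∀ a ∈ (Finset.range (n + 1)).filter (Edge n L),
          u n a * accCount n a b ≤ (n : ℝ) ^ L := by
        intro a ha
        rw [Finset.mem_filter, Finset.mem_range] at ha
        have han : a ≤ n := by omega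
        have h1 : accCount n a b ≤ n ^ L := by
          refine (accCount_le_choose_left n a b).trans ((choose_le_pow_endDist han).trans ?_)
          rcases Nat.eq_zero_or_pos n with hn | hn
          · have : endDist n a = 0 := by simp only [endDist]; omega
            rw [this, pow_zero]
            by_contra hlt
            exact hmid (Or.inl (by omega))
          · exact Nat.pow_le_pow_right hn ((edge_iff han).mp ha.2)
        calc u n a * accCount n a b ≤ 1 * accCount n a b :=
              mul_le_mul_of_nonneg_right ((hd n).le_one a han) (Nat.cast_nonneg _)
          _ ≤ _ := by rw [one_mul]; exact_mod_cast h1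
      refine (Finset.sum_le_card_nsmul _ _ _ hterm).trans ?_
      rw [nsmul_eq_mul]
      refine mul_le_mul_of_nonneg_right ?_ (by positivity)
      exact_mod_cast card_edge_le n L
  rw [edge_iff hb, not_le] at hmid
  -- The three terms are the bits needed for `n ^ L`, for `2 * (L + 1)`, and for half of the target
  -- bound.
  have hexp : lam n * L + (L + 1) + (lam n ^ c + 1) ≤ endDist n b := by
    refine le_trans ?_ hmid.le
    have e1 : lam n ^ (c₁ + c + 2) = lam n * (lam n * (L * lam n ^ c)) := by rw [hL]; ring
    rw [e1]
    have h1 : L ≤ L * lam n ^ c := Nat.le_mul_of_pos_right _ hc1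
    have h2 : lam n ^ c ≤ L * lam n ^ c := Nat.le_mul_of_pos_left _ hL1
    have h3 : L * lam n ^ c ≤ lam n * (L * lam n ^ c) := Nat.le_mul_of_pos_left _ (by omega)
    have h4 := Nat.mul_le_mul_right (lam n * (L * lam n ^ c)) h5
    have h5 := Nat.mul_le_mul_left (lam n) h1
    omega
  have hsecond : (2 * (L + 1)) * n ^ L * 2 ^ (lam n ^ c + 1) ≤ n.choose b := by
    calc (2 * (L + 1)) * n ^ L * 2 ^ (lam n ^ c + 1)
        ≤ 2 ^ (L + 1) * (2 ^ lam n) ^ L * 2 ^ (lam n ^ c + 1) := by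
          have h1 : 2 * (L + 1) ≤ 2 ^ (L + 1) := by
            rw [pow_succ, mul_comm]
            exact Nat.mul_le_mul_right _ Nat.lt_two_pow_self
          have h2 := (lt_two_pow_lam n).le
          gcongr
      _ = 2 ^ (lam n * L + (L + 1) + (lam n ^ c + 1)) := by
          rw [← pow_mul, ← pow_add, ← pow_add]; ring_nf
      _ ≤ 2 ^ endDist n b := Nat.pow_le_pow_right two_pos hexp
      _ ≤ _ := two_pow_endDist_le hb
  have hfirst : ((1 : ℝ) / 2) ^ lam n ^ (c + 1) ≤ (1 / 2) ^ (lam n ^ c + 1) := by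
    refine pow_le_pow_of_le_one (by norm_num) (by norm_num) ?_
    rw [pow_succ]
    nlinarith
  have hsecond' : (2 * ((L : ℝ) + 1)) * n ^ L ≤ (1 / 2) ^ (lam n ^ c + 1) * n.choose b := by
    rw [div_pow, one_pow, one_div_mul_eq_div, le_div_iff₀ (by positivity)]
    exact_mod_cast hsecond
  rw [FastCodes.stepA, div_le_iff₀ hC]
  calc _ ≤ _ := hsum
    _ ≤ (1 / 2) ^ (lam n ^ c + 1) * n.choose b + (1 / 2) ^ (lam n ^ c + 1) * n.choose b := by gcongr
    _ = _ := by rw [pow_succ]; ring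

/-- For a source of weight `w` the decay `n ^ (-⌈w/2⌉)` cancels the growth `n ^ ⌊w/2⌋` of
`accCount`. Only `w ≤ 2 * i + 1` occur, and dividing by `n.choose b` leaves about `n ^ (-i)`. -/
theorem SmallEnds.stepA {u : ℕ → ℕ → ℝ} (hd : ∀ n, IsDensity n (u n)) (hu : SmallEnds u) :
    SmallEnds fun n => stepA n (u n) := by
  intro c
  obtain ⟨c₁, h⟩ := hu (c + 2)
  refine ⟨c + (c + 2) + 3 * (c₁ + (c + 1)), ?_⟩
  filter_upwards [h, eventually_le_lam 4, eventually_lam_pow_le (c + 3)] with n h h4 hn b hb hb0 hi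
  have hC := choose_cast_pos hb
  set i := endDist n b with hidef
  rcases Nat.eq_zero_or_pos i with hi0 | hi0
  · rw [hi0]
    simpa using (hd n).stepA.le_one b hb
  set L := lam n ^ c with hL
  set K := lam n ^ c₁ with hK
  have hL1 : 1 ≤ L := Nat.one_le_pow _ _ (by omega)
  have hK1 : 1 ≤ K := Nat.one_le_pow _ _ (by omega)
  have hL2 : 4 * L ≤ lam n ^ (c + 2) := by
    rw [pow_add, mul_comm, sq]
    exact Nat.mul_le_mul_left _ (by nlinarith)
  have hL3 : L + 1 ≤ lam n ^ (c + 1) := by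
    rw [pow_succ]; nlinarith
  have hL4 : 4 * lam n ^ (c + 2) ≤ n := by
    refine le_trans ?_ hn
    rw [pow_succ _ (c + 2), mul_comm]
    exact Nat.mul_le_mul_left _ h4
  have hn0 : 0 < n := by omega
  set X := (K * (L + 1)) ^ (2 * i + 1) with hX
  have hsum : ∑ w ∈ Finset.range (n + 1), u n w * accCount n w b ≤ ((2 * i + 1 : ℕ) + 1) * (X : ℝ) := by
    refine sum_range_le_of_support (Nat.cast_nonneg _) ?_ ?_
    · intro w hw hwi
      rcases eq_or_ne w 0 with rfl | hw0
      · rw [(hd n).zero, zero_mul]; exact Nat.cast_nonneg _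
      have hend : endDist n w = w := by simp only [endDist]; omega
      have h1 := h w (by omega) hw0 (by omega)
      rw [hend] at h1
      have h2 : accCount n w b ≤ n ^ ((w + 1) / 2) * (L + 1) ^ w :=
        (accCount_le_of_edge hw0 ((edge_iff hb).mpr hi)).trans
          (Nat.mul_le_mul_right _ (Nat.pow_le_pow_right hn0 (by omega)))
      have h3 : (K * (L + 1)) ^ w ≤ X := Nat.pow_le_pow_right (by positivity) hwi
      calc u n w * accCount n w b ≤ u n w * (n ^ ((w + 1) / 2) * (L + 1) ^ w) :=
            mul_le_mul_of_nonneg_left (by exact_mod_cast h2) ((hd n).nonneg w)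
        _ = u n w * n ^ ((w + 1) / 2) * (L + 1) ^ w := by ring
        _ ≤ ((lam n : ℝ) ^ c₁) ^ w * (L + 1) ^ w := by gcongr
        _ = (((K * (L + 1)) ^ w : ℕ) : ℝ) := by rw [hK]; push_cast; rw [mul_pow]
        _ ≤ X := by exact_mod_cast h3
    · intro w hw hwi
      by_contra hne
      have hacc : accCount n w b ≠ 0 := fun h0 => hne (by rw [h0]; simp)
      obtain ⟨h1, h2, h3⟩ := le_of_accCount_ne_zero (by omega) hacc
      simp only [endDist] at hidef
      omega
  have hpow : n ^ i ≤ L ^ i * n.choose b :=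
    (pow_endDist_le hb).trans (Nat.mul_le_mul_right _ (Nat.pow_le_pow_left hi i))
  have hfin : (2 * i + 1 + 1) * X * L ^ i ≤ (lam n ^ (c + (c + 2) + 3 * (c₁ + (c + 1)))) ^ i := by
    have h1 : 2 * i + 1 + 1 ≤ (4 * L) ^ i :=
      (show 2 * i + 1 + 1 ≤ 4 * L by omega).trans (Nat.le_self_pow hi0.ne' _)
    have h2 : X ≤ ((K * (L + 1)) ^ 3) ^ i := by
      rw [hX, ← pow_mul]
      exact Nat.pow_le_pow_right (by positivity) (by omega)
    calc (2 * i + 1 + 1) * X * L ^ i ≤ (4 * L) ^ i * ((K * (L + 1)) ^ 3) ^ i * L ^ i :=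
          Nat.mul_le_mul_right _ (Nat.mul_le_mul h1 h2)
      _ = (L * (4 * L) * (K * (L + 1)) ^ 3) ^ i := by
          rw [mul_pow _ ((K * (L + 1)) ^ 3), mul_pow L]; ring
      _ ≤ (lam n ^ c * lam n ^ (c + 2) * (lam n ^ c₁ * lam n ^ (c + 1)) ^ 3) ^ i := by gcongr
      _ = _ := by rw [← pow_add, ← pow_add, ← pow_mul, ← pow_add]; ring_nf
  have hstep : 0 ≤ FastCodes.stepA n (u n) b := stepA_nonneg (hd n).nonneg b
  calc FastCodes.stepA n (u n) b * (n : ℝ) ^ ((i + 1) / 2)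
      ≤ FastCodes.stepA n (u n) b * (n : ℝ) ^ i := by
        refine mul_le_mul_of_nonneg_left ?_ hstep
        exact pow_le_pow_right₀ (by exact_mod_cast hn0) (by omega)
    _ ≤ FastCodes.stepA n (u n) b * (L ^ i * n.choose b) :=
        mul_le_mul_of_nonneg_left (by exact_mod_cast hpow) hstep
    _ = (∑ w ∈ Finset.range (n + 1), u n w * accCount n w b) * L ^ i := by
        rw [FastCodes.stepA]; field_simp
    _ ≤ ((2 * i + 1 : ℕ) + 1) * (X : ℝ) * L ^ i :=
        mul_le_mul_of_nonneg_right hsum (by positivity)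
    _ ≤ _ := by exact_mod_cast hfin

/-! ### The density of the repeated messages -/

/-- The square is a single term of Vandermonde's sum. -/
theorem choose_sq_le_choose_two_mul (q j : ℕ) : q.choose j ^ 2 ≤ (2 * q).choose (2 * j) := by
  rw [two_mul q, two_mul j, Nat.add_choose_eq, sq]
  exact Finset.single_le_sum (f := fun ij : ℕ × ℕ => q.choose ij.1 * q.choose ij.2)
    (fun _ _ => Nat.zero_le _) (a := (j, j)) (by simp)

theorem initialDensity_nonneg (n w : ℕ) : 0 ≤ initialDensity n w := by
  rw [initialDensity]
  split_ifs <;> positivity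

theorem initialDensity_sq_mul_choose_le {n w : ℕ} (hw : w ≤ n) :
    initialDensity n w ^ 2 * n.choose w ≤ 1 := by
  rw [initialDensity]
  split_ifs with h
  · have hC := choose_cast_pos hw
    obtain ⟨-, j, rfl⟩ := h
    have h1 : (n / 2).choose ((j + j) / 2) ^ 2 ≤ n.choose (j + j) := by
      rw [show (j + j) / 2 = j by omega, ← two_mul]
      exact (choose_sq_le_choose_two_mul _ _).trans (Nat.choose_le_choose _ (Nat.mul_div_le n 2))
    have h2 : ((n / 2).choose ((j + j) / 2) : ℝ) ^ 2 ≤ n.choose (j + j) := by exact_mod_cast h1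
    rw [div_pow, sq (n.choose (j + j) : ℝ), div_mul_eq_mul_div, div_le_one (by positivity)]
    exact mul_le_mul_of_nonneg_right h2 hC.le
  · simp

theorem isDensity_initialDensity (n : ℕ) : IsDensity n (initialDensity n) where
  nonneg := initialDensity_nonneg n
  le_one w hw := by
    have h := initialDensity_sq_mul_choose_le hw
    have hC : (1 : ℝ) ≤ n.choose w := by exact_mod_cast Nat.choose_pos hw
    have h0 := initialDensity_nonneg n w
    refine (sq_le_one_iff₀ h0).mp (le_trans ?_ h)
    exact le_mul_of_one_le_right (sq_nonneg _) hC
  zero := by simp [initialDensity]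

theorem smallMiddle_initialDensity : SmallMiddle initialDensity := by
  intro c
  refine ⟨c + 1, ?_⟩
  filter_upwards [eventually_le_lam 2] with n h2 w hw hmid
  rw [edge_iff hw, not_le] at hmid
  have h := initialDensity_sq_mul_choose_le hw
  refine (pow_le_pow_iff_left₀ (initialDensity_nonneg n w) (by positivity) two_ne_zero).mp ?_
  have hexp : 2 ^ (lam n ^ c * 2) ≤ n.choose w := by
    refine le_trans (Nat.pow_le_pow_right two_pos ?_) (two_pow_endDist_le hw)
    refine le_trans ?_ hmid.le
    rw [pow_succ]
    exact Nat.mul_le_mul_left _ h2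
  rw [← pow_mul, div_pow, one_pow, le_div_iff₀ (by positivity)]
  exact (mul_le_mul_of_nonneg_left (by exact_mod_cast hexp) (sq_nonneg _)).trans h

theorem smallEnds_initialDensity : SmallEnds initialDensity := by
  intro c
  refine ⟨c, ?_⟩
  filter_upwards [eventually_even, eventually_le_lam 1] with n hn h1 w hw hw0 hi
  by_cases hpar : Even w
  swap
  · rw [initialDensity, if_neg (fun h => hpar h.2), zero_mul]
    positivity
  have h0 := initialDensity_nonneg n w
  have h := initialDensity_sq_mul_choose_le hw
  -- With `n` and `w` even the distance is an even number `2 * k`, so the square root of `1 /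
  -- n.choose w` yields exactly `n ^ (-k)` with no loss in rounding.
  obtain ⟨k, hk⟩ : ∃ k, endDist n w = 2 * k := by
    obtain ⟨a, rfl⟩ := hn
    obtain ⟨b, rfl⟩ := hpar
    exact ⟨endDist a b, by simp only [endDist]; omega⟩
  have hpow := pow_endDist_le hw
  rw [hk] at hi hpow ⊢
  rw [show (2 * k + 1) / 2 = k by omega]
  refine (pow_le_pow_iff_left₀ (by positivity) (by positivity) two_ne_zero).mp ?_
  have h2 : (2 * k) ^ (2 * k) ≤ ((lam n ^ c) ^ (2 * k)) ^ 2 :=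
    (Nat.pow_le_pow_left hi _).trans (Nat.le_self_pow two_ne_zero _)
  calc (initialDensity n w * (n : ℝ) ^ k) ^ 2 = initialDensity n w ^ 2 * (n : ℝ) ^ (2 * k) := by ring
    _ ≤ initialDensity n w ^ 2 * (((2 * k : ℕ) : ℝ) ^ (2 * k) * n.choose w) :=
        mul_le_mul_of_nonneg_left (by exact_mod_cast hpow) (sq_nonneg _)
    _ = initialDensity n w ^ 2 * n.choose w * ((2 * k : ℕ) : ℝ) ^ (2 * k) := by ring
    _ ≤ 1 * ((2 * k : ℕ) : ℝ) ^ (2 * k) := mul_le_mul_of_nonneg_right h (by positivity)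
    _ ≤ _ := by rw [one_mul]; exact_mod_cast h2

/-! ### The mass near the ends of the weight range -/

/-- Only `a ≤ 2 * L + 1` have nonzero `edgeProb`, and there are at most `n ^ (2 * L + 1)` vectors of
such a weight. -/
theorem sum_middle_le {n L : ℕ} {v : ℕ → ℝ} {y : ℝ} (hv : IsDensity n v) (hy : 0 ≤ y) (hn : 0 < n)
    {s : Finset ℕ} (hs : s ⊆ Finset.range (n + 1)) (hmid : ∀ w ∈ s, v w ≤ y) :
    ∑ w ∈ s, ∑ a ∈ Finset.range (n + 1), v w * accCount n a w * edgeProb n L a ≤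
      ((n : ℝ) + 1) ^ 2 * n ^ (2 * L + 1) * y := by
  have hterm : ∀ w ∈ s, ∀ a ∈ Finset.range (n + 1),
      v w * accCount n a w * edgeProb n L a ≤ n ^ (2 * L + 1) * y := by
    intro w hw a ha
    rcases lt_or_ge (2 * L + 1) a with h | h
    · rw [edgeProb_eq_zero h, mul_zero]; positivity
    have h1 : accCount n a w ≤ n ^ (2 * L + 1) := (accCount_le_choose_left n a w).trans
      ((Nat.choose_le_pow n a).trans (Nat.pow_le_pow_right hn h))
    have h2 : (accCount n a w : ℝ) ≤ (n : ℝ) ^ (2 * L + 1) := by exact_mod_cast h1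
    calc v w * accCount n a w * edgeProb n L a ≤ v w * accCount n a w * 1 :=
          mul_le_mul_of_nonneg_left (edgeProb_le_one (by simpa [Nat.lt_succ_iff] using ha))
            (mul_nonneg (hv.nonneg w) (Nat.cast_nonneg _))
      _ = accCount n a w * v w := by ring
      _ ≤ _ := mul_le_mul h2 (hmid w hw) (hv.nonneg w) (by positivity)
  calc _ ≤ ∑ w ∈ s, ∑ a ∈ Finset.range (n + 1), (n : ℝ) ^ (2 * L + 1) * y :=
        Finset.sum_le_sum fun w hw => Finset.sum_le_sum (hterm w hw)
    _ ≤ ∑ w ∈ Finset.range (n + 1), ∑ a ∈ Finset.range (n + 1), (n : ℝ) ^ (2 * L + 1) * y :=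
        Finset.sum_le_sum_of_subset_of_nonneg hs fun _ _ _ => by positivity
    _ = _ := by
        simp only [Finset.sum_const, Finset.card_range, nsmul_eq_mul]
        push_cast
        ring

/-- Up to a negligible term, only densities near the ends contribute to the mass near the ends
after one round. -/
theorem edgeMass_round_le {u : ℕ → ℕ → ℝ} (hd : ∀ n, IsDensity n (u n)) (hu : SmallMiddle u)
    (c K : ℕ) : ∃ c', ∀ᶠ n in evenAtTop, edgeMass n (lam n ^ c) (stepA n (stepD n (u n))) ≤
      (∑ w ∈ (Finset.range (n + 1)).filter (Edge n (lam n ^ c')), ∑ a ∈ Finset.range (n + 1),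
        u n w * accCount n a w * edgeProb n (lam n ^ c) a) + 1 / n ^ K := by
  obtain ⟨c', h⟩ := hu (c + 2)
  refine ⟨c', ?_⟩
  filter_upwards [h, eventually_mul_half_pow_le c K, eventually_lam_pow_le 0] with n h h1 hn
  rw [edgeMass_stepA_stepD, ← Finset.sum_filter_add_sum_filter_not _ (Edge n (lam n ^ c'))]
  refine add_le_add le_rfl ((sum_middle_le (hd n) (by positivity) hn (Finset.filter_subset _ _)
    fun w hw => ?_).trans h1)
  rw [Finset.mem_filter, Finset.mem_range] at hw
  exact h w (by omega) hw.2

/-- The step preserves total mass, so sources near the ends contribute at most their own mass.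
Middle sources reach only quasipolynomially many target vectors near the ends. -/
theorem edgeMass_stepD_le {u : ℕ → ℕ → ℝ} (hd : ∀ n, IsDensity n (u n)) (hu : SmallMiddle u)
    (c K : ℕ) : ∃ c', ∀ᶠ n in evenAtTop, edgeMass n (lam n ^ c) (stepD n (u n)) ≤
      edgeMass n (lam n ^ c') (u n) + 1 / n ^ K := by
  obtain ⟨c', h⟩ := hu (c + 2)
  refine ⟨c', ?_⟩
  filter_upwards [h, eventually_mul_half_pow_le c K, eventually_lam_pow_le 0] with n h h1 hn
  rw [pow_zero] at hn
  rw [edgeMass_stepD, ← Finset.sum_filter_add_sum_filter_not _ (Edge n (lam n ^ c'))]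
  refine add_le_add (Finset.sum_le_sum fun a _ => ?_) (le_trans ?_ h1)
  · rw [← Finset.mul_sum, mul_comm]
    refine mul_le_mul_of_nonneg_right ?_ ((hd n).nonneg a)
    rw [← sum_accCount_left n a, Nat.cast_sum]
    exact Finset.sum_le_sum_of_subset_of_nonneg (Finset.filter_subset _ _)
      fun _ _ _ => Nat.cast_nonneg _
  · set L := lam n ^ c
    set y : ℝ := (1 / 2) ^ lam n ^ (c + 2)
    have hy : 0 ≤ y := by positivity
    have hterm : ∀ a ∈ (Finset.range (n + 1)).filter (fun a => ¬ Edge n (lam n ^ c') a),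
        ∀ b ∈ (Finset.range (n + 1)).filter (Edge n L),
        u n a * accCount n b a ≤ n ^ (2 * L + 1) * y := by
      intro a ha b hb
      rw [Finset.mem_filter, Finset.mem_range] at ha hb
      have hbn : b ≤ n := by omega
      have h2 : accCount n b a ≤ n ^ (2 * L + 1) := by
        refine (accCount_le_choose_left n b a).trans ((choose_le_pow_endDist hbn).trans
          (Nat.pow_le_pow_right hn ?_))
        have := (edge_iff hbn).mp hb.2
        omega
      have h3 : (accCount n b a : ℝ) ≤ (n : ℝ) ^ (2 * L + 1) := by exact_mod_cast h2
      rw [mul_comm]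
      exact mul_le_mul h3 (h a (by omega) ha.2) ((hd n).nonneg a) (by positivity)
    calc _ ≤ ∑ a ∈ (Finset.range (n + 1)).filter (fun a => ¬ Edge n (lam n ^ c') a),
          ∑ b ∈ (Finset.range (n + 1)).filter (Edge n L), (n : ℝ) ^ (2 * L + 1) * y :=
          Finset.sum_le_sum fun a ha => Finset.sum_le_sum (hterm a ha)
      _ ≤ ∑ a ∈ Finset.range (n + 1), ∑ b ∈ Finset.range (n + 1), (n : ℝ) ^ (2 * L + 1) * y := by
          refine (Finset.sum_le_sum_of_subset_of_nonneg (Finset.filter_subset _ _)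
            fun _ _ _ => by positivity).trans (Finset.sum_le_sum fun _ _ => ?_)
          exact Finset.sum_le_sum_of_subset_of_nonneg (Finset.filter_subset _ _)
            fun _ _ _ => by positivity
      _ = _ := by
          simp only [Finset.sum_const, Finset.card_range, nsmul_eq_mul]
          push_cast
          ring

theorem edgeFactor_le {n : ℕ} (c : ℕ) (h : 2 ≤ lam n) :
    2 * (lam n ^ c + 1) * (lam n ^ c + 1) * (2 * lam n ^ c + 1) ≤ lam n ^ (3 * c + 5) := by
  have hL : 1 ≤ lam n ^ c := Nat.one_le_pow _ _ (by omega)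
  calc 2 * (lam n ^ c + 1) * (lam n ^ c + 1) * (2 * lam n ^ c + 1)
      ≤ 2 * (2 * lam n ^ c) * (2 * lam n ^ c) * (2 * (2 * lam n ^ c)) := by
        gcongr <;> omega
    _ = 2 ^ 5 * (lam n ^ c) ^ 3 := by ring
    _ ≤ lam n ^ 5 * (lam n ^ c) ^ 3 := by gcongr
    _ = _ := by rw [← pow_mul, ← pow_add]; ring_nf

/-- Every further round divides the mass near the ends by about `n`. -/
theorem edgeMass_round_le_div {u : ℕ → ℕ → ℝ} (hd : ∀ n, IsDensity n (u n)) (hu : SmallMiddle u)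
    (c K : ℕ) : ∃ c' d, ∀ᶠ n in evenAtTop, edgeMass n (lam n ^ c) (stepA n (stepD n (u n))) ≤
      lam n ^ d / n * edgeMass n (lam n ^ c') (u n) + 1 / n ^ K := by
  obtain ⟨c', h⟩ := edgeMass_round_le hd hu c K
  refine ⟨c', (3 * c + 5) * 2, ?_⟩
  filter_upwards [h, eventually_le_lam 2, eventually_lam_pow_le ((3 * c + 5) * 2)] with n h h2 hn
  refine h.trans (add_le_add ?_ le_rfl)
  rw [edgeMass, Finset.mul_sum]
  refine Finset.sum_le_sum fun w _ => ?_
  have hn0 : 0 < n := lt_of_lt_of_le (by positivity) hn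
  rcases eq_or_ne w 0 with rfl | hw0
  · simp [(hd n).zero]
  have hprob : ∀ a, a ≠ 0 → edgeProb n (lam n ^ c) a ≤ (lam n : ℝ) ^ ((3 * c + 5) * 2) / n := by
    intro a ha
    rw [le_div_iff₀ (by exact_mod_cast hn0)]
    have h3 := Nat.pow_le_pow_left (edgeFactor_le c h2) 2
    rw [← pow_mul] at h3
    refine (edgeProb_mul_le ha (h3.trans hn)).trans ?_
    exact_mod_cast h3
  -- The probability bound is uniform in `a ≠ 0`, and the counts sum to `n.choose w`; `a = 0` does
  -- not occur because `w ≠ 0`.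
  calc _ ≤ ∑ a ∈ Finset.range (n + 1), u n w * accCount n a w *
          ((lam n : ℝ) ^ ((3 * c + 5) * 2) / n) := by
        refine Finset.sum_le_sum fun a _ => ?_
        rcases eq_or_ne a 0 with rfl | ha
        · simp [accCount_zero_left hw0]
        · exact mul_le_mul_of_nonneg_left (hprob a ha)
            (mul_nonneg ((hd n).nonneg w) (Nat.cast_nonneg _))
    _ = _ := by
        rw [← Finset.sum_mul, ← Finset.mul_sum, ← sum_accCount_left n w, Nat.cast_sum]
        ring

/-- The powers of `n` are `-⌈i/2⌉` from the density, `⌊a/2⌋` from the count and `-⌈a/2⌉` from the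
probability, where `i = endDist n w`. The last two together are never positive, and `i ≥ 1` already
gives `1 / n`. -/
theorem edgeTerm_le {n L L₁ K Q : ℕ} {v : ℕ → ℝ} (hv : IsDensity n v) {w a : ℕ} (hw : w ≤ n)
    (hi : endDist n w ≤ L₁) (ha : a ≠ 0) (hacc : accCount n a w ≠ 0) (hK : 1 ≤ K) (hQ : 1 ≤ Q)
    (hn : (K * ((L₁ + 1) * Q) ^ 3) ^ 2 ≤ n)
    (hP : edgeProb n L a * n ^ ((a + 1) / 2) ≤ (Q : ℝ) ^ a)
    (hend : v w * n ^ ((endDist n w + 1) / 2) ≤ (K : ℝ) ^ endDist n w) :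
    v w * accCount n a w * edgeProb n L a ≤ ((K * ((L₁ + 1) * Q) ^ 3) ^ 2 : ℕ) / n := by
  obtain ⟨h1, h2, -⟩ := le_of_accCount_ne_zero ha hacc
  generalize hS : (L₁ + 1) * Q = S at *
  generalize hZ : K * S ^ 3 = Z at *
  have hS1 : 1 ≤ S := by rw [← hS]; exact Nat.mul_pos (Nat.succ_pos _) hQ
  have hSZ : S ≤ Z := by
    rw [← hZ]
    exact (Nat.le_self_pow three_ne_zero S).trans (Nat.le_mul_of_pos_left _ hK)
  have hZ1 : 1 ≤ Z := hS1.trans hSZ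
  have hn0 : 0 < n := lt_of_lt_of_le (by positivity) hn
  have hn0' : (0 : ℝ) < n := by exact_mod_cast hn0
  have hu0 := hv.nonneg w
  have hP0 := edgeProb_nonneg n L a
  have hcount : (accCount n a w : ℝ) ≤ n ^ (a / 2) * (L₁ + 1) ^ a := by
    exact_mod_cast accCount_le_of_edge ha ((edge_iff hw).mpr hi)
  have hai : a ≤ 2 * endDist n w + 1 := by simp only [endDist]; omega
  have hidef : endDist n w = 0 → a = 1 := by omega
  generalize endDist n w = i at *
  have hcP : accCount n a w * edgeProb n L a * n ^ ((a + 1) / 2) ≤ n ^ (a / 2) * (S : ℝ) ^ a := by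
    calc accCount n a w * edgeProb n L a * n ^ ((a + 1) / 2)
        = accCount n a w * (edgeProb n L a * n ^ ((a + 1) / 2)) := by ring
      _ ≤ (n ^ (a / 2) * (L₁ + 1) ^ a) * (Q : ℝ) ^ a :=
          mul_le_mul hcount hP (by positivity) (by positivity)
      _ = _ := by rw [← hS]; push_cast; rw [mul_pow]; ring
  rw [le_div_iff₀ hn0']
  -- For `i = 0` the density gives no decay, but then `a = 1`, and the probability supplies `1 / n`.
  rcases Nat.eq_zero_or_pos i with hi0 | hi0
  · obtain rfl := hidef hi0
    have hu1 := hv.le_one w hw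
    have hle : accCount n 1 w * edgeProb n L 1 * n ≤ (S : ℝ) := by simpa using hcP
    have hSZ2 : S ≤ Z ^ 2 := hSZ.trans (Nat.le_self_pow two_ne_zero Z)
    calc v w * accCount n 1 w * edgeProb n L 1 * n
        = v w * (accCount n 1 w * edgeProb n L 1 * n) := by ring
      _ ≤ 1 * S := mul_le_mul hu1 hle (by positivity) zero_le_one
      _ ≤ _ := by rw [one_mul]; exact_mod_cast hSZ2
  · have hcP' : accCount n a w * edgeProb n L a ≤ (S : ℝ) ^ (3 * i) := by
      have hpos : (0 : ℝ) < n ^ ((a + 1) / 2) := by positivity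
      refine le_of_mul_le_mul_right (hcP.trans ?_) hpos
      rw [mul_comm]
      refine mul_le_mul ?_ ?_ (by positivity) (by positivity)
      · exact pow_le_pow_right₀ (by exact_mod_cast hS1) (by omega)
      · exact pow_le_pow_right₀ (by exact_mod_cast hn0) (by omega)
    have hpos : (0 : ℝ) < n ^ ((i + 1) / 2) := by positivity
    refine le_of_mul_le_mul_right ?_ hpos
    calc v w * accCount n a w * edgeProb n L a * n * n ^ ((i + 1) / 2)
        = (v w * n ^ ((i + 1) / 2)) * (accCount n a w * edgeProb n L a) * n := by ring
      _ ≤ (K : ℝ) ^ i * (S : ℝ) ^ (3 * i) * n := by gcongr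
      _ = (Z : ℝ) ^ i * n := by rw [← hZ]; push_cast; rw [mul_pow, ← pow_mul]
      _ ≤ (Z : ℝ) ^ 2 * n ^ ((i + 1) / 2) :=
          pow_le_sq_mul_pow (by exact_mod_cast hZ1) (by exact_mod_cast hn) hi0.ne'
      _ = _ := by push_cast; rfl

theorem sum_edge_le {n L L₁ : ℕ} {v : ℕ → ℝ} {y : ℝ} (hv : IsDensity n v) (hy : 0 ≤ y)
    (h : ∀ w, w ≤ n → w ≠ 0 → endDist n w ≤ L₁ → ∀ a, a ≠ 0 → accCount n a w ≠ 0 →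
      v w * accCount n a w * edgeProb n L a ≤ y) :
    ∑ w ∈ (Finset.range (n + 1)).filter (Edge n L₁), ∑ a ∈ Finset.range (n + 1),
      v w * accCount n a w * edgeProb n L a ≤ (2 * (L₁ + 1) * (2 * L₁ + 1 + 1) : ℕ) * y := by
  have hinner : ∀ w ∈ (Finset.range (n + 1)).filter (Edge n L₁),
      ∑ a ∈ Finset.range (n + 1), v w * accCount n a w * edgeProb n L a ≤
        ((2 * L₁ + 1 : ℕ) + 1) * y := by
    intro w hw
    rw [Finset.mem_filter, Finset.mem_range] at hw
    have hwn : w ≤ n := by omega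
    refine sum_range_le_of_support hy (fun a _ _ => ?_) fun a _ haL => ?_
    · by_cases hacc : accCount n a w = 0
      · rwa [hacc, Nat.cast_zero, mul_zero, zero_mul]
      rcases eq_or_ne w 0 with rfl | hw0
      · rwa [hv.zero, zero_mul, zero_mul]
      · exact h w hwn hw0 ((edge_iff hwn).mp hw.2) a
          (fun ha => hacc (by rw [ha]; exact accCount_zero_left hw0)) hacc
    · by_contra hne
      have hacc : accCount n a w ≠ 0 := fun h0 => hne (by rw [h0]; simp)
      obtain ⟨h1, h2, h3⟩ := le_of_accCount_ne_zero (by omega) hacc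
      rcases hw.2 with h5 | h5 <;> omega
  refine (Finset.sum_le_card_nsmul _ _ _ hinner).trans ?_
  rw [nsmul_eq_mul, Nat.cast_mul, mul_assoc]
  refine mul_le_mul (by exact_mod_cast card_edge_le n L₁) (by push_cast; rfl) ?_ (Nat.cast_nonneg _)
  positivity

/-- The first round leaves a mass of about `1 / n` near the ends. -/
theorem edgeMass_first_round_le {u : ℕ → ℕ → ℝ} (hd : ∀ n, IsDensity n (u n)) (hu : SmallMiddle u)
    (he : SmallEnds u) (c : ℕ) : ∃ c', ∀ᶠ n in evenAtTop,
      edgeMass n (lam n ^ c) (stepA n (stepD n (u n))) ≤ lam n ^ c' / n := by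
  obtain ⟨c₁, h⟩ := edgeMass_round_le hd hu c 1
  obtain ⟨c₂, h'⟩ := he c₁
  -- The exponent of `lam n` in `(K * ((L₁ + 1) * Q) ^ 3) ^ 2` from `edgeTerm_le`.
  set z := (c₂ + (c₁ + 1 + (3 * c + 5)) * 3) * 2 with hz
  -- Both summands `c₁ + 2` absorb the number of pairs `(w, a)`; the final 1 absorbs the error `1 /
  -- n`.
  refine ⟨(c₁ + 2) + (c₁ + 2) + z + 1, ?_⟩
  filter_upwards [h, h', eventually_le_lam 4, eventually_lam_pow_le z,
    eventually_lam_pow_le (c + 2)] with n h h' h4 hn hnc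
  have hn0 : 0 < n := lt_of_lt_of_le (by positivity) hn
  have hn0' : (0 : ℝ) < n := by exact_mod_cast hn0
  have hL1 : 1 ≤ lam n ^ c₁ := Nat.one_le_pow _ _ (by omega)
  have hLc : 1 ≤ lam n ^ c := Nat.one_le_pow _ _ (by omega)
  have hK1 : 1 ≤ lam n ^ c₂ := Nat.one_le_pow _ _ (by omega)
  have h16 : ∀ e, 16 * lam n ^ e ≤ lam n ^ (e + 2) := fun e => by
    rw [pow_add, mul_comm]
    exact Nat.mul_le_mul_left _ (Nat.pow_le_pow_left h4 2)
  have hQ := edgeFactor_le c (by omega : 2 ≤ lam n)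
  have hncond : 2 * (2 * lam n ^ c + 1) ≤ n := by
    have := h16 c
    omega
  have hZ : (lam n ^ c₂ * ((lam n ^ c₁ + 1) * lam n ^ (3 * c + 5)) ^ 3) ^ 2 ≤ lam n ^ z := by
    have h5 : lam n ^ c₁ + 1 ≤ lam n ^ (c₁ + 1) := by
      have := Nat.mul_le_mul_left (lam n ^ c₁) h4
      rw [pow_succ]; omega
    calc _ ≤ (lam n ^ c₂ * (lam n ^ (c₁ + 1) * lam n ^ (3 * c + 5)) ^ 3) ^ 2 := by gcongr
      _ = _ := by rw [hz, ← pow_add, ← pow_mul, ← pow_add, ← pow_mul]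
  have hsum := sum_edge_le (L := lam n ^ c) (L₁ := lam n ^ c₁) (hd n)
    (y := ((lam n ^ z : ℕ) : ℝ) / n) (by positivity) fun w hw hw0 hi a ha hacc => by
      refine (edgeTerm_le (K := lam n ^ c₂) (Q := lam n ^ (3 * c + 5)) (hd n) hw hi ha hacc hK1
        (Nat.one_le_pow _ _ (by omega)) (hZ.trans hn) ?_ ?_).trans ?_
      · refine (edgeProb_mul_pow_le ha hncond).trans ?_
        refine pow_le_pow_left₀ (by positivity) ?_ a
        exact_mod_cast hQ
      · exact_mod_cast h' w hw hw0 hi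
      · exact div_le_div_of_nonneg_right (by exact_mod_cast hZ) hn0'.le
  have hnum : 2 * (lam n ^ c₁ + 1) * (2 * lam n ^ c₁ + 1 + 1) * lam n ^ z + 1 ≤
      lam n ^ ((c₁ + 2) + (c₁ + 2) + z + 1) := by
    have h5 : 2 * (lam n ^ c₁ + 1) ≤ lam n ^ (c₁ + 2) := by
      have := h16 c₁
      omega
    have h6 : 2 * (lam n ^ c₁ + 1) * (2 * lam n ^ c₁ + 1 + 1) * lam n ^ z ≤
        lam n ^ ((c₁ + 2) + (c₁ + 2) + z) := by
      rw [pow_add, pow_add _ (c₁ + 2)]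
      exact Nat.mul_le_mul_right _ (Nat.mul_le_mul h5 (by omega))
    have h7 : 1 ≤ lam n ^ ((c₁ + 2) + (c₁ + 2) + z) := Nat.one_le_pow _ _ (by omega)
    have h8 := Nat.mul_le_mul_left (lam n ^ ((c₁ + 2) + (c₁ + 2) + z)) h4
    rw [pow_succ]
    omega
  rw [pow_one] at h
  calc _ ≤ _ := h
    _ ≤ _ := add_le_add hsum le_rfl
    _ = ((2 * (lam n ^ c₁ + 1) * (2 * lam n ^ c₁ + 1 + 1) * lam n ^ z + 1 : ℕ) : ℝ) / n := by
        push_cast; ring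
    _ ≤ _ := div_le_div_of_nonneg_right (by exact_mod_cast hnum) hn0'.le

theorem round_iterate {u : ℕ → ℕ → ℝ} (hd : ∀ n, IsDensity n (u n)) (hu : SmallMiddle u) (k : ℕ) :
    (∀ n, IsDensity n ((fun v => stepA n (stepD n v))^[k] (u n))) ∧
      SmallMiddle fun n => (fun v => stepA n (stepD n v))^[k] (u n) := by
  induction k with
  | zero => exact ⟨hd, hu⟩
  | succ k ih =>
    simp only [Function.iterate_succ_apply']
    exact ⟨fun n => (ih.1 n).stepD.stepA, ih.2.stepD.stepA fun n => (ih.1 n).stepD⟩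

theorem edgeMass_iterate_le {u : ℕ → ℕ → ℝ} (hd : ∀ n, IsDensity n (u n)) (hu : SmallMiddle u)
    (he : SmallEnds u) (k c : ℕ) : ∃ c', ∀ᶠ n in evenAtTop,
      edgeMass n (lam n ^ c) ((fun v => stepA n (stepD n v))^[k + 1] (u n)) ≤
        lam n ^ c' / n ^ (k + 1) := by
  induction k generalizing c with
  | zero => simpa using edgeMass_first_round_le hd hu he c
  | succ k ih =>
    obtain ⟨hd', hu'⟩ := round_iterate hd hu (k + 1)
    obtain ⟨c₁, d, h₁⟩ := edgeMass_round_le_div hd' hu' c (k + 2)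
    obtain ⟨c₂, h₂⟩ := ih c₁
    refine ⟨d + c₂ + 1, ?_⟩
    filter_upwards [h₁, h₂, eventually_le_lam 2, eventually_lam_pow_le 0] with n h₁ h₂ h2 hn
    have hn0 : (0 : ℝ) < n := by exact_mod_cast hn
    rw [Function.iterate_succ_apply']
    have hnum : lam n ^ d * lam n ^ c₂ + 1 ≤ lam n ^ (d + c₂ + 1) := by
      have : 1 ≤ lam n ^ (d + c₂) := Nat.one_le_pow _ _ (by omega)
      rw [← pow_add, pow_succ _ (d + c₂)]
      nlinarith
    have hnum' : (lam n : ℝ) ^ d * lam n ^ c₂ + 1 ≤ lam n ^ (d + c₂ + 1) := by exact_mod_cast hnum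
    calc _ ≤ _ := h₁
      _ ≤ lam n ^ d / n * (lam n ^ c₂ / n ^ (k + 1)) + 1 / n ^ (k + 2) := by gcongr
      _ = ((lam n : ℝ) ^ d * lam n ^ c₂ + 1) / n ^ (k + 1 + 1) := by
          rw [div_mul_div_comm, ← pow_succ', ← add_div]
      _ ≤ _ := by gcongr

/-! ### The theorem -/

theorem edgeWidth_le (n : ℕ) : edgeWidth n ≤ ((lam n ^ 2 : ℕ) : ℝ) := by
  rcases Nat.eq_zero_or_pos n with rfl | hn
  · simp [edgeWidth]
  · have h0 : 0 ≤ Real.logb 2 n := Real.logb_nonneg one_lt_two (by exact_mod_cast hn)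
    rw [edgeWidth]
    push_cast
    exact pow_le_pow_left₀ h0 (logb_le_lam n) 2

theorem starDA_bound (t : Bool) (ε : ℝ) (k : ℕ) : ∃ c, ∀ᶠ n in evenAtTop,
    starDA t ε (k + 2) n ≤ lam n ^ c / n ^ (k + 1) := by
  obtain ⟨c, h⟩ := edgeMass_iterate_le isDensity_initialDensity smallMiddle_initialDensity
    smallEnds_initialDensity k 2
  exact ⟨c, h.mono fun n hn => (starDA_le t ε (k + 2) (edgeWidth_le n)).trans hn⟩

theorem iterate_stepD_stepA (n k : ℕ) (v : ℕ → ℝ) :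
    (fun u => stepD n (stepA n u))^[k + 1] v =
      stepD n ((fun u => stepA n (stepD n u))^[k] (stepA n v)) := by
  induction k generalizing v with
  | zero => rfl
  | succ k ih => rw [Function.iterate_succ_apply, ih, Function.iterate_succ_apply]

/-- Of the `m - 1` rounds one factor `n` is lost to regrouping, since the initial `A` and the final
`D` bring no gain. -/
theorem starAD_bound (t : Bool) (ε : ℝ) (k : ℕ) : ∃ c, ∀ᶠ n in evenAtTop,
    starAD t ε (k + 3) n ≤ lam n ^ c / n ^ (k + 1) := by
  have hd : ∀ n, IsDensity n (stepA n (initialDensity n)) :=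
    fun n => (isDensity_initialDensity n).stepA
  have hm := smallMiddle_initialDensity.stepA isDensity_initialDensity
  have he := smallEnds_initialDensity.stepA isDensity_initialDensity
  obtain ⟨hd', hm'⟩ := round_iterate hd hm (k + 1)
  obtain ⟨c₁, h₁⟩ := edgeMass_stepD_le hd' hm' 2 (k + 1)
  obtain ⟨c₂, h₂⟩ := edgeMass_iterate_le hd hm he k c₁
  refine ⟨c₂ + 1, ?_⟩
  filter_upwards [h₁, h₂, eventually_le_lam 2] with n h₁ h₂ h2
  refine (starAD_le t ε (k + 3) (edgeWidth_le n)).trans ?_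
  rw [show k + 3 - 1 = k + 1 + 1 by omega, iterate_stepD_stepA]
  have hnum : lam n ^ c₂ + 1 ≤ lam n ^ (c₂ + 1) := by
    have : 1 ≤ lam n ^ c₂ := Nat.one_le_pow _ _ (by omega)
    rw [pow_succ]
    nlinarith
  have hnum' : (lam n : ℝ) ^ c₂ + 1 ≤ lam n ^ (c₂ + 1) := by exact_mod_cast hnum
  calc _ ≤ _ := h₁
    _ ≤ lam n ^ c₂ / n ^ (k + 1) + 1 / n ^ (k + 1) := by gcongr
    _ = ((lam n : ℝ) ^ c₂ + 1) / n ^ (k + 1) := by ring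
    _ ≤ _ := by gcongr

/-! ### Conversion to asymptotic notation -/

theorem isSoftO_of_le {f : ℕ → ℝ} {c k : ℕ} {s : ℝ} (hf : ∀ n, 0 ≤ f n) (hs : -(k : ℝ) ≤ s)
    (h : ∀ᶠ n in evenAtTop, f n ≤ lam n ^ c / n ^ k) : IsSoftO f fun n => (n : ℝ) ^ s := by
  refine ⟨c, IsBigO.of_bound (2 ^ c) ?_⟩
  filter_upwards [h, (eventually_ge_atTop 2).filter_mono inf_le_left] with n h hn
  have hn1 : (1 : ℝ) ≤ n := by exact_mod_cast (by omega : 1 ≤ n)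
  have hlog : 0 ≤ Real.logb 2 n := Real.logb_nonneg one_lt_two hn1
  rw [Real.norm_of_nonneg (hf n), Real.norm_of_nonneg (by positivity)]
  calc f n ≤ lam n ^ c / n ^ k := h
    _ = lam n ^ c * (n : ℝ) ^ (-(k : ℝ)) := by
        rw [Real.rpow_neg (by positivity), Real.rpow_natCast, div_eq_mul_inv]
    _ ≤ (2 * Real.logb 2 n) ^ c * (n : ℝ) ^ s := by
        have h1 := lam_le_two_mul_logb hn
        have h2 := Real.rpow_le_rpow_of_exponent_le hn1 hs
        gcongr
    _ = _ := by rw [mul_pow]; ring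

theorem isInversePoly_of_le {f : ℕ → ℝ} {c k : ℕ} (hf : ∀ n, 0 ≤ f n)
    (h : ∀ᶠ n in evenAtTop, f n ≤ lam n ^ c / n ^ (k + 1)) : IsInversePoly f := by
  refine ⟨1 / 2, by norm_num, ?_⟩
  filter_upwards [h, eventually_lam_pow_le (c * 2), eventually_lam_pow_le 0] with n h h1 hn
  rw [pow_zero] at hn
  have hn1 : (1 : ℝ) ≤ n := by exact_mod_cast hn
  have hn0 : (0 : ℝ) < n := by positivity
  have h2 : (lam n : ℝ) ^ c ≤ Real.sqrt n := by
    refine Real.le_sqrt_of_sq_le ?_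
    rw [← pow_mul]
    exact_mod_cast h1
  rw [abs_of_nonneg (hf n)]
  calc f n ≤ lam n ^ c / n ^ (k + 1) := h
    _ ≤ Real.sqrt n / n := by
        have : (n : ℝ) ≤ n ^ (k + 1) := le_self_pow₀ hn1 (Nat.succ_ne_zero k)
        gcongr
    _ = (n : ℝ) ^ (-(1 / 2 : ℝ)) := by
        rw [Real.rpow_neg hn0.le, ← Real.sqrt_eq_rpow, div_eq_iff hn0.ne', inv_mul_eq_div,
          eq_div_iff (Real.sqrt_pos.mpr hn0).ne', Real.mul_self_sqrt hn0.le]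

end FastCodes

end

theorem theorem5p1 (ε : ℝ) (hε : 0 < ε) (m : ℕ) (transposed : Bool) :
    (2 ≤ m →
      FastCodes.IsSoftO (FastCodes.starDA transposed ε m)
        (fun n => (n : ℝ) ^ ((1 : ℝ) / 4 - (m : ℝ) / 2)) ∧
      FastCodes.IsInversePoly (FastCodes.starDA transposed ε m)) ∧
    (3 ≤ m →
      FastCodes.IsSoftO (FastCodes.starAD transposed ε m)
        (fun n => (n : ℝ) ^ ((1 : ℝ) / 4 - (m : ℝ) / 4)) ∧
      FastCodes.IsInversePoly (FastCodes.starAD transposed ε m)) := by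
  constructor
  · intro hm
    obtain ⟨k, rfl⟩ := Nat.exists_eq_add_of_le' hm
    obtain ⟨c, h⟩ := FastCodes.starDA_bound transposed ε k
    refine ⟨FastCodes.isSoftO_of_le (fun n => FastCodes.expectedEdgeCount_nonneg _ _ _ _ _ _) ?_ h,
      FastCodes.isInversePoly_of_le (fun n => FastCodes.expectedEdgeCount_nonneg _ _ _ _ _ _) h⟩
    -- This is `-(m - 1) ≤ 1/4 - m/2` for `m = k + 2`.
    push_cast
    linarith [(Nat.cast_nonneg k : (0 : ℝ) ≤ k)]
  · intro hm
    obtain ⟨k, rfl⟩ := Nat.exists_eq_add_of_le' hm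
    obtain ⟨c, h⟩ := FastCodes.starAD_bound transposed ε k
    refine ⟨FastCodes.isSoftO_of_le (fun n => FastCodes.expectedEdgeCount_nonneg _ _ _ _ _ _) ?_ h,
      FastCodes.isInversePoly_of_le (fun n => FastCodes.expectedEdgeCount_nonneg _ _ _ _ _ _) h⟩
    -- This is `-(m - 2) ≤ 1/4 - m/4` for `m = k + 3`; it would fail at `m = 2`.
    push_cast
    linarith [(Nat.cast_nonneg k : (0 : ℝ) ≤ k)]
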